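/- **Setting.** Let $n\ge 1$, $2\le p<\infty$, and let $\Omega\subset\mathbb R^n$ be a bounded domain with smooth boundary $\Gamma=\partial\Omega$. Let $B$ be the open unit ball of $\mathbb R^n$, $S=\partial B$, and let $\Phi(x,y)=(x,\Psi(x,y))$ with $\Psi:\Omega\times B\to\mathbb R^n$; put $\Omega_x=\Psi(x,B)$ (the cell at $x$) and $Q=\bigcup_{x\in\Omega}\{x\}\times\Omega_x=\Phi(\Omega\times B)$. Assume that $\Phi:\Omega\times B\to Q$ is bijective, that $\Phi$ and $\Phi^{-1}$ are Lipschitz continuous, that for each $x\in\Omega$ the map $\Psi(x,\cdot)$ is (extends to) a $C^\infty$-diffeomorphism from $\overline B$ onto $\overline{\Omega_x}$ mapping $S$ onto $\partial\Omega_x$, and that the $L_p$-norms of $\partial_y^\alpha\Phi(x,\cdot)$ on $B$ and of $\partial_z^\alpha\Phi^{-1}(x,\cdot)$ on $\Omega_x$, $|\alpha|\le2$, are bounded uniformly in $x\in\Omega$. Write $\Phi^*U=U\circ\Phi$. For $s\in\{0,1,2\}$ let $L_p(\Omega,W^s_p(\Omega_x))$ be the space of all $U$ on $Q$ with $\Phi^*U\in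 L_p(\Omega,W^s_p(B))$ (Bochner space, $W^0_p=L_p$), normed by $\|\Phi^*U\|_{L_p(\Omega,W^s_p(B))}$. All functions are real valued. Let $g_{ij}=(\partial_{y_i}\Phi\,|\,\partial_{y_j}\Phi)$, $|g|=\det(g_{ij})$, $(g^{ij})=(g_{ij})^{-1}$, and $$\mathcal A_xv=-\frac1{\sqrt{|g(x)|}}\sum_{i,j}\partial_{y_i}\bigl(\sqrt{|g(x)|}\,g^{ij}(x)\,\partial_{y_j}v\bigr),\qquad q(U)(x)=-\int_S\sum_{i,j}\sqrt{|g(x)|}\,g^{ij}(x)\,\partial_{y_i}(\Phi^*U)(x)\,\nu_j\,ds,$$ where $\nu$ is the outer unit normal of $B$ and boundary values are traces. Define the operator $\mathbf A^N$ by $$\mathbf A^N(u,U)=\bigl(-\Delta_xu,\;[\mathcal A_x(\Phi^*U)(x)]\circ\Phi^{-1}\bigr)$$ on the set of all $(u,U)$ with $u\in W^2_p(\Omega)$, $\partial_\nu u=0$ on $\Gamma$, $U\in L_p(\Omega,W^2_p(\Omega_x))$, such that for almost every $x\in\Omega$ the trace of $(\Phi^*U)(x)$ on $S$ is the constant $u(x)$.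 **Proposition (mass conservation, Neumann case).** Let $(u_0,U_0)\in W^1_p(\Omega)\times L_p(\Omega,W^1_p(\Omega_x))$, $T>0$, and let $(u,U)$ be a strong solution on $[0,T]$ of $$\partial_t(u,U)+\mathbf A^N(u,U)=(q(U),0),\quad t\in(0,T),\qquad (u,U)(0)=(u_0,U_0),$$ that is, $(u,U)$ is continuous on $[0,T]$ and differentiable on $(0,T)$ with values in $L_p(\Omega)\times L_p(\Omega,L_p(\Omega_x))$, takes values in the domain of $\mathbf A^N$ for $t\in(0,T)$, and satisfies the equation there. Then the total mass $$S(u,U)=\int_\Omega u\,dx+\int_\Omega\int_B\sqrt{|g|}\,\Phi^*U\,dy\,dx$$ is constant in time: $S(u(t),U(t))=S(u_0,U_0)$ for all $t\in[0,T]$. -/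

import Mathlib

open MeasureTheory Filter Topology Metric Set
open scoped ENNReal NNReal ContDiff

noncomputable section

namespace Matched

/-- Euclidean space `ℝⁿ`. -/
abbrev Eu (n : ℕ) : Type := EuclideanSpace ℝ (Fin n)

/-- The `i`-th standard basis vector. -/
def basisVec {n : ℕ} (i : Fin n) : Eu n := EuclideanSpace.single i 1

/-- The standard cell, the open unit ball `B`. -/
def unitBall (n : ℕ) : Set (Eu n) := ball 0 1

/-! ### Smooth domains -/

/-- `ρ` is a smooth function that defines `Ω` near its boundary point `x`. -/
def IsLocalDefiningFunction {n : ℕ} (Ω : Set (Eu n)) (x : Eu n) (ρ : Eu n → ℝ) : Prop :=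
  ContDiff ℝ ∞ ρ ∧ ρ x = 0 ∧ gradient ρ x ≠ 0 ∧ ∀ᶠ y in 𝓝 x, (y ∈ Ω ↔ ρ y < 0)

/-- A bounded domain (nonempty, open and connected) with smooth boundary. -/
structure IsSmoothBoundedDomain {n : ℕ} (Ω : Set (Eu n)) : Prop where
  isOpen : IsOpen Ω
  isConnected : IsConnected Ω
  isBounded : Bornology.IsBounded Ω
  smooth : ∀ x ∈ frontier Ω, ∃ ρ, IsLocalDefiningFunction Ω x ρ

/-- `ν` is the outer unit normal of `Ω` at the boundary point `x`. -/
def IsOuterUnitNormal {n : ℕ} (Ω : Set (Eu n)) (x ν : Eu n) : Prop :=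
  ∃ ρ, IsLocalDefiningFunction Ω x ρ ∧ ν = ‖gradient ρ x‖⁻¹ • gradient ρ x

/-- The `(n-1)`-dimensional Hausdorff measure on the boundary of `Ω`. Mathlib's Hausdorff measure
agrees with the classical surface measure up to a positive constant factor; this measure is only
used for null sets and for convergence in `L_p`, so the factor does not matter. -/
def boundaryMeasure {n : ℕ} (Ω : Set (Eu n)) : Measure (Eu n) :=
  (Measure.hausdorffMeasure ((n : ℝ) - 1)).restrict (frontier Ω)

/-- The surface measure `ds` on the unit sphere `S` (with the classical normalisation), as a measure
on `ℝⁿ` that is concentrated on `S`. -/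
def sphereMeasure (n : ℕ) : Measure (Eu n) :=
  ((volume : Measure (Eu n)).toSphere).map Subtype.val

/-! ### Weak derivatives, Sobolev spaces, traces -/

/-- On the open set `O`, `h` is the weak `i`-th partial derivative of `f`. -/
def HasWeakPartial {n : ℕ} (O : Set (Eu n)) (i : Fin n) (f h : Eu n → ℝ) : Prop :=
  LocallyIntegrableOn f O volume ∧ LocallyIntegrableOn h O volume ∧
    ∀ φ : Eu n → ℝ, ContDiff ℝ ∞ φ → HasCompactSupport φ → tsupport φ ⊆ O →
      ∫ y in O, f y * fderiv ℝ φ y (basisVec i) = -∫ y in O, h y * φ y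

lemma integrableOn_mul_test {n : ℕ} {O : Set (Eu n)} {f φ : Eu n → ℝ}
    (hf : LocallyIntegrableOn f O volume) (hφ : Continuous φ) (hc : HasCompactSupport φ)
    (hs : tsupport φ ⊆ O) : IntegrableOn (fun y => f y * φ y) O volume := by
  have h1 : IntegrableOn (fun y => f y * φ y) (tsupport φ) volume :=
    (hf.integrableOn_compact_subset hs hc).mul_continuousOn hφ.continuousOn hc
  refine Integrable.integrableOn ?_
  rwa [← integrableOn_iff_integrable_of_support_subset]
  intro y hy
  refine subset_tsupport φ ?_
  rw [Function.mem_support] at hy ⊢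
  exact right_ne_zero_of_mul hy

lemma integrableOn_mul_test_deriv {n : ℕ} {O : Set (Eu n)} {f φ : Eu n → ℝ} (v : Eu n)
    (hf : LocallyIntegrableOn f O volume) (hφ : ContDiff ℝ ∞ φ) (hc : HasCompactSupport φ)
    (hs : tsupport φ ⊆ O) : IntegrableOn (fun y => f y * fderiv ℝ φ y v) O volume := by
  refine integrableOn_mul_test hf ((hφ.continuous_fderiv (by simp)).clm_apply continuous_const)
    (hc.fderiv_apply (𝕜 := ℝ) v) ?_
  exact (tsupport_fderiv_apply_subset ℝ v).trans hs

lemma LocallyIntegrableOn.congr_on {n : ℕ} {O : Set (Eu n)} {f f' : Eu n → ℝ}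
    (hf : LocallyIntegrableOn f O volume) (h : f =ᵐ[volume.restrict O] f') :
    LocallyIntegrableOn f' O volume := by
  intro x hx
  obtain ⟨t, ht, hi⟩ := hf x hx
  refine ⟨t ∩ O, inter_mem ht self_mem_nhdsWithin, ?_⟩
  exact (hi.mono_set inter_subset_left).congr (ae_restrict_of_ae_restrict_of_subset
    inter_subset_right h)

lemma HasWeakPartial.congr {n : ℕ} {O : Set (Eu n)} {i : Fin n} {f h f' h' : Eu n → ℝ}
    (H : HasWeakPartial O i f h) (hf : f =ᵐ[volume.restrict O] f')
    (hh : h =ᵐ[volume.restrict O] h') : HasWeakPartial O i f' h' := by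
  refine ⟨LocallyIntegrableOn.congr_on H.1 hf, LocallyIntegrableOn.congr_on H.2.1 hh,
    fun φ h1 h2 h3 => ?_⟩
  have e1 : ∫ y in O, f' y * fderiv ℝ φ y (basisVec i) = ∫ y in O, f y * fderiv ℝ φ y (basisVec i) :=
    integral_congr_ae (by filter_upwards [hf] with y hy; rw [hy])
  have e2 : ∫ y in O, h' y * φ y = ∫ y in O, h y * φ y :=
    integral_congr_ae (by filter_upwards [hh] with y hy; rw [hy])
  rw [e1, e2]
  exact H.2.2 φ h1 h2 h3

lemma HasWeakPartial.zero {n : ℕ} (O : Set (Eu n)) (i : Fin n) :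
    HasWeakPartial O i (0 : Eu n → ℝ) (0 : Eu n → ℝ) :=
  ⟨locallyIntegrableOn_zero, locallyIntegrableOn_zero, fun φ _ _ _ => by simp⟩

lemma HasWeakPartial.add {n : ℕ} {O : Set (Eu n)} {i : Fin n} {f h f' h' : Eu n → ℝ}
    (H : HasWeakPartial O i f h) (H' : HasWeakPartial O i f' h') :
    HasWeakPartial O i (f + f') (h + h') := by
  refine ⟨H.1.add H'.1, H.2.1.add H'.2.1, fun φ h1 h2 h3 => ?_⟩
  simp only [Pi.add_apply, add_mul]
  rw [integral_add (integrableOn_mul_test_deriv _ H.1 h1 h2 h3)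
      (integrableOn_mul_test_deriv _ H'.1 h1 h2 h3),
    integral_add (integrableOn_mul_test H.2.1 h1.continuous h2 h3)
      (integrableOn_mul_test H'.2.1 h1.continuous h2 h3),
    H.2.2 φ h1 h2 h3, H'.2.2 φ h1 h2 h3]
  ring

lemma HasWeakPartial.const_smul {n : ℕ} {O : Set (Eu n)} {i : Fin n} {f h : Eu n → ℝ} (c : ℝ)
    (H : HasWeakPartial O i f h) : HasWeakPartial O i (c • f) (c • h) := by
  refine ⟨H.1.smul c, H.2.1.smul c, fun φ h1 h2 h3 => ?_⟩
  simp only [Pi.smul_apply, smul_eq_mul, mul_assoc, integral_const_mul]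
  rw [H.2.2 φ h1 h2 h3]
  ring

/-- `L_p(O)`. -/
abbrev LpOn {n : ℕ} (p : ℝ≥0∞) (O : Set (Eu n)) : Type :=
  Lp ℝ p ((volume : Measure (Eu n)).restrict O)

/-- The Sobolev space `W_p^1(O)`: the functions `f` in `L_p(O)` together with their weak gradient
`(∂_i f)_i` in `L_p(O)`; its norm is the maximum of the `L_p`-norms of all components, which is
equivalent to the usual norm. -/
def W1 {n : ℕ} (p : ℝ≥0∞) [Fact (1 ≤ p)] (O : Set (Eu n)) :
    Submodule ℝ (LpOn p O × (Fin n → LpOn p O)) where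
  carrier := {F | ∀ i, HasWeakPartial O i F.1 (F.2 i)}
  zero_mem' i := (HasWeakPartial.zero O i).congr (Lp.coeFn_zero ℝ p _).symm
    (Lp.coeFn_zero ℝ p _).symm
  add_mem' {F G} hF hG i := ((hF i).add (hG i)).congr (Lp.coeFn_add F.1 G.1).symm
    (Lp.coeFn_add (F.2 i) (G.2 i)).symm
  smul_mem' c F hF i := ((hF i).const_smul c).congr (Lp.coeFn_smul c F.1).symm
    (Lp.coeFn_smul c (F.2 i)).symm

/-- The Sobolev space `W_p^2(O)`: the functions `f` in `L_p(O)` together with their weak partial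
derivatives of first order, `∂_i f`, and of second order, `∂_j ∂_i f` (the entry `i j`). -/
def W2 {n : ℕ} (p : ℝ≥0∞) [Fact (1 ≤ p)] (O : Set (Eu n)) :
    Submodule ℝ (LpOn p O × (Fin n → LpOn p O) × (Fin n → Fin n → LpOn p O)) where
  carrier := {F | (∀ i, HasWeakPartial O i F.1 (F.2.1 i)) ∧
    ∀ i j, HasWeakPartial O j (F.2.1 i) (F.2.2 i j)}
  zero_mem' := ⟨fun i => (HasWeakPartial.zero O i).congr (Lp.coeFn_zero ℝ p _).symm
      (Lp.coeFn_zero ℝ p _).symm,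
    fun _ j => (HasWeakPartial.zero O j).congr (Lp.coeFn_zero ℝ p _).symm
      (Lp.coeFn_zero ℝ p _).symm⟩
  add_mem' {F G} hF hG := ⟨fun i => ((hF.1 i).add (hG.1 i)).congr (Lp.coeFn_add F.1 G.1).symm
      (Lp.coeFn_add (F.2.1 i) (G.2.1 i)).symm,
    fun i j => ((hF.2 i j).add (hG.2 i j)).congr (Lp.coeFn_add (F.2.1 i) (G.2.1 i)).symm
      (Lp.coeFn_add (F.2.2 i j) (G.2.2 i j)).symm⟩
  smul_mem' c F hF := ⟨fun i => ((hF.1 i).const_smul c).congr (Lp.coeFn_smul c F.1).symm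
      (Lp.coeFn_smul c (F.2.1 i)).symm,
    fun i j => ((hF.2 i j).const_smul c).congr (Lp.coeFn_smul c (F.2.1 i)).symm
      (Lp.coeFn_smul c (F.2.2 i j)).symm⟩

section Components

variable {n : ℕ} {p : ℝ≥0∞} [Fact (1 ≤ p)] {O : Set (Eu n)}

/-- The function underlying an element of `W_p^1(O)`. -/
def W1.fn (F : W1 p O) : LpOn p O := F.1.1

/-- The function underlying an element of `W_p^2(O)`. -/
def W2.fn (F : W2 p O) : LpOn p O := F.1.1

/-- `∂_i f` for `f` in `W_p^2(O)`. -/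
def W2.d (F : W2 p O) (i : Fin n) : LpOn p O := F.1.2.1 i

/-- `∂_j ∂_i f` for `f` in `W_p^2(O)`. -/
def W2.dd (F : W2 p O) (i j : Fin n) : LpOn p O := F.1.2.2 i j

/-- The Laplacian `∑ ∂_i ∂_i f` of `f` in `W_p^2(O)`. -/
def W2.laplacian (F : W2 p O) : LpOn p O := ∑ i, W2.dd F i i

end Components

/-- `τ` in `L_p(∂O, σ)` is the trace on `∂O` of the function `f` in `W_p^1(O)` with weak gradient
`df`: there are smooth functions on `ℝⁿ` whose restrictions to `O` converge to `f` in `W_p^1(O)`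
and whose restrictions to `∂O` converge to `τ` in `L_p(∂O, σ)`. Here `σ` is the surface measure
on `∂O`. -/
def HasTrace {n : ℕ} (p : ℝ≥0∞) (O : Set (Eu n)) (σ : Measure (Eu n))
    (f : Eu n → ℝ) (df : Fin n → Eu n → ℝ) (τ : Eu n → ℝ) : Prop :=
  MemLp τ p σ ∧ ∃ φ : ℕ → Eu n → ℝ, (∀ k, ContDiff ℝ ∞ (φ k)) ∧
    Tendsto (fun k => eLpNorm (fun y => φ k y - f y) p (volume.restrict O)) atTop (𝓝 0) ∧
    (∀ i, Tendsto (fun k => eLpNorm (fun y => fderiv ℝ (φ k) y (basisVec i) - df i y) p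
      (volume.restrict O)) atTop (𝓝 0)) ∧
    Tendsto (fun k => eLpNorm (fun y => φ k y - τ y) p σ) atTop (𝓝 0)

/-! ### Geometry of the cells -/

/-- The cell `Ω_x = Ψ(x, B)`. -/
def cell {n : ℕ} (Ψ : Eu n → Eu n → Eu n) (x : Eu n) : Set (Eu n) := Ψ x '' unitBall n

/-- The map `Φ(x, y) = (x, Ψ(x, y))`. -/
def cellMap {n : ℕ} (Ψ : Eu n → Eu n → Eu n) (z : Eu n × Eu n) : Eu n × Eu n := (z.1, Ψ z.1 z.2)

/-- The set `Q = Φ(Ω × B)`, the union of all `{x} × Ω_x`, `x ∈ Ω`. -/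
def cellSet {n : ℕ} (Ω : Set (Eu n)) (Ψ : Eu n → Eu n → Eu n) : Set (Eu n × Eu n) :=
  cellMap Ψ '' (Ω ×ˢ unitBall n)

/-- The standing assumptions on the family of cells. Here `Ψ x` is used on the closed unit ball,
for `x` in `Ω`, and `Θ x` is the inverse of `Ψ x`, defined on the closure of `Ω_x`. -/
structure IsCellGeometry {n : ℕ} (p : ℝ≥0∞) (Ω : Set (Eu n)) (Ψ : Eu n → Eu n → Eu n) :
    Prop where
  /-- `Φ` is Lipschitz continuous on `Ω × B`. -/
  lipschitz : ∃ K : ℝ≥0, LipschitzOnWith K (cellMap Ψ) (Ω ×ˢ unitBall n)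
  /-- `Φ` is injective on `Ω × B` and `Φ⁻¹` is Lipschitz continuous on `Q`. -/
  lipschitz_inv : ∃ K : ℝ≥0, ∀ z ∈ Ω ×ˢ unitBall n, ∀ w ∈ Ω ×ˢ unitBall n,
    dist z w ≤ K * dist (cellMap Ψ z) (cellMap Ψ w)
  /-- For `x ∈ Ω`, `Ψ x` is a `C^∞` diffeomorphism of the closed unit ball onto the closure of
  `Ω_x` that maps the unit sphere onto the boundary of `Ω_x`, and the derivatives of `Ψ x` and of
  its inverse up to order two are bounded in `L_p`, uniformly in `x`. -/
  diffeo : ∃ Θ : Eu n → Eu n → Eu n,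
    (∀ x ∈ Ω, ContDiffOn ℝ ∞ (Ψ x) (closedBall 0 1) ∧
      ContDiffOn ℝ ∞ (Θ x) (closure (cell Ψ x)) ∧
      Ψ x '' closedBall 0 1 = closure (cell Ψ x) ∧
      Ψ x '' sphere 0 1 = frontier (cell Ψ x) ∧
      LeftInvOn (Θ x) (Ψ x) (closedBall 0 1)) ∧
    ∃ C : ℝ≥0, ∀ x ∈ Ω, ∀ k : ℕ, k ≤ 2 →
      eLpNorm (iteratedFDeriv ℝ k (Ψ x)) p (volume.restrict (unitBall n)) ≤ C ∧
      eLpNorm (iteratedFDeriv ℝ k (Θ x)) p (volume.restrict (cell Ψ x)) ≤ C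

section Metric

variable {n : ℕ} (Ψ : Eu n → Eu n → Eu n)

/-- The vector `∂_{y_i} Ψ(x, y)`, for `y` in the closed unit ball. Since the first component of `Φ`
does not depend on `y`, this is also `∂_{y_i} Φ(x, y)`. -/
def cellDeriv (x y : Eu n) (i : Fin n) : Eu n :=
  fderivWithin ℝ (Ψ x) (closedBall 0 1) y (basisVec i)

/-- The Riemannian metric `g_{ij} = (∂_{y_i} Φ | ∂_{y_j} Φ)`. -/
def gMat (x y : Eu n) : Matrix (Fin n) (Fin n) ℝ :=
  Matrix.of fun i j => inner ℝ (cellDeriv Ψ x y i) (cellDeriv Ψ x y j)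

/-- The volume density `√|g|`. -/
def sqrtG (x y : Eu n) : ℝ := Real.sqrt (gMat Ψ x y).det

/-- The inverse metric `g^{ij}`. -/
def gInv (x y : Eu n) (i j : Fin n) : ℝ := (gMat Ψ x y)⁻¹ i j

end Metric

/-! ### Function spaces on the cells -/

/-- `L_p(Q)`, in which the densities `U` in the cells live. -/
abbrev LpQ {n : ℕ} (p : ℝ≥0∞) (Ω : Set (Eu n)) (Ψ : Eu n → Eu n → Eu n) : Type :=
  Lp ℝ p ((volume : Measure (Eu n × Eu n)).restrict (cellSet Ω Ψ))

/-- `L_p(Ω, X)` in the sense of Bochner. -/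
abbrev LpBochner {n : ℕ} (p : ℝ≥0∞) (Ω : Set (Eu n)) (X : Type) [NormedAddCommGroup X] : Type :=
  Lp X p ((volume : Measure (Eu n)).restrict Ω)

/-- `V = Φ^* U = U ∘ Φ`, for `U` in `L_p(Ω, L_p(Ω_x))` and `V` in `L_p(Ω, L_p(B))`. -/
def IsPullback {n : ℕ} {p : ℝ≥0∞} [Fact (1 ≤ p)] {Ω : Set (Eu n)} {Ψ : Eu n → Eu n → Eu n}
    (U : LpQ p Ω Ψ) (V : LpBochner p Ω (LpOn p (unitBall n))) : Prop :=
  ∀ᵐ x ∂volume.restrict Ω,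
    (V x : Eu n → ℝ) =ᵐ[volume.restrict (unitBall n)] fun y => U (cellMap Ψ (x, y))

/-- `u ∈ W_p^1(Ω)`. -/
def MemW1 {n : ℕ} {p : ℝ≥0∞} [Fact (1 ≤ p)] {Ω : Set (Eu n)} (u : LpOn p Ω) : Prop :=
  ∃ v : W1 p Ω, W1.fn v = u

/-- `U ∈ L_p(Ω, W_p^1(Ω_x)) = Φ_* L_p(Ω, W_p^1(B))`. -/
def MemLpW1 {n : ℕ} {p : ℝ≥0∞} [Fact (1 ≤ p)] {Ω : Set (Eu n)} {Ψ : Eu n → Eu n → Eu n}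
    (U : LpQ p Ω Ψ) : Prop :=
  ∃ V : LpBochner p Ω (LpOn p (unitBall n)), IsPullback U V ∧
    ∃ W : LpBochner p Ω (W1 p (unitBall n)), ∀ᵐ x ∂volume.restrict Ω, W1.fn (W x) = V x

/-! ### The operators -/

/-- The Neumann condition `∂_ν u = 0` on `∂Ω` for `u` in `W_p^2(Ω)`: the first order partial
derivatives of `u` have traces `τ_i` with `∑ τ_i ν_i = 0` almost everywhere on `∂Ω`. -/
def NeumannCondition {n : ℕ} {p : ℝ≥0∞} [Fact (1 ≤ p)] {Ω : Set (Eu n)} (u : W2 p Ω) : Prop :=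
  ∃ τ : Fin n → Eu n → ℝ,
    (∀ i, HasTrace p Ω (boundaryMeasure Ω) (W2.d u i) (fun j => W2.dd u i j) (τ i)) ∧
    ∀ᵐ x ∂boundaryMeasure Ω, ∃ ν : Eu n, IsOuterUnitNormal Ω x ν ∧ ∑ i, τ i x * ν i = 0

/-- `F = 𝒜_x v = -(1/√|g|) ∑ ∂_{y_i} (√|g| g^{ij} ∂_{y_j} v)` on `B`, for `v` in `W_p^2(B)`. -/
def IsLaplaceBeltrami {n : ℕ} {p : ℝ≥0∞} [Fact (1 ≤ p)] (Ψ : Eu n → Eu n → Eu n) (x : Eu n)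
    (v : W2 p (unitBall n)) (F : Eu n → ℝ) : Prop :=
  ∃ h : Fin n → Fin n → Eu n → ℝ,
    (∀ i j, HasWeakPartial (unitBall n) i (fun y => sqrtG Ψ x y * gInv Ψ x y i j * W2.d v j y)
      (h i j)) ∧
    F =ᵐ[volume.restrict (unitBall n)] fun y => -(1 / sqrtG Ψ x y) * ∑ i, ∑ j, h i j y

/-- `r = -∫_S √|g| g^{ij} ∂_{y_i} v ν_j ds`, for `v` in `W_p^2(B)`; the `τ_i` are the traces of the
`∂_{y_i} v`, and the outer normal of `B` at a point `s` of `S` is `s` itself. -/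
def IsExchange {n : ℕ} {p : ℝ≥0∞} [Fact (1 ≤ p)] (Ψ : Eu n → Eu n → Eu n) (x : Eu n)
    (v : W2 p (unitBall n)) (r : ℝ) : Prop :=
  ∃ τ : Fin n → Eu n → ℝ,
    (∀ i, HasTrace p (unitBall n) (sphereMeasure n) (W2.d v i) (fun j => W2.dd v i j) (τ i)) ∧
    r = -∫ s, ∑ i, ∑ j, sqrtG Ψ x s * gInv Ψ x s i j * τ i s * s j ∂sphereMeasure n

/-- For `w = (u, U)` given through `(u, V)`, `V = Φ^* U`: `w` is in the domain of `𝐀^N`, the pair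
`(f, F)` is `𝐀^N w` (with the second component pulled back to `B`), and `q = q(U)`.
The domain consists of the `(u, U)` with `u ∈ W_p^2(Ω)`, `∂_ν u = 0` on `∂Ω`,
`U ∈ L_p(Ω, W_p^2(Ω_x))` and `tr U = u`, that is, for almost every `x` the trace of `V(x)` on the
sphere is the constant `u(x)`. -/
def IsNeumannOperator {n : ℕ} {p : ℝ≥0∞} [Fact (1 ≤ p)] {Ω : Set (Eu n)}
    (Ψ : Eu n → Eu n → Eu n) (u : LpOn p Ω) (V : LpBochner p Ω (LpOn p (unitBall n)))
    (f : LpOn p Ω) (F : LpBochner p Ω (LpOn p (unitBall n))) (q : LpOn p Ω) : Prop :=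
  (∃ v : W2 p Ω, W2.fn v = u ∧ NeumannCondition v ∧ f = -W2.laplacian v) ∧
  ∃ W : LpBochner p Ω (W2 p (unitBall n)), ∀ᵐ x ∂volume.restrict Ω,
    W2.fn (W x) = V x ∧
    HasTrace p (unitBall n) (sphereMeasure n) (W2.fn (W x)) (fun i => W2.d (W x) i)
      (fun _ => u x) ∧
    IsLaplaceBeltrami Ψ x (W x) (F x) ∧
    IsExchange Ψ x (W x) (q x)

/-- `(u, U)` is a strong solution on `[0, T]` of
`∂_t (u, U) + 𝐀^N (u, U) = (q(U), 0)`, `(u, U)(0) = (u₀, U₀)`: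
it is continuous on `[0, T]` and differentiable on `(0, T)` with values in
`L_p(Ω) × L_p(Ω, L_p(Ω_x))`, takes values in the domain of `𝐀^N` for `t ∈ (0, T)`, and satisfies the
equation there. The norm of `U` in `L_p(Ω, L_p(Ω_x))` is by definition the norm of `Φ^* U` in
`L_p(Ω, L_p(B))`, so continuity and derivatives are those of `(u, Φ^* U)`. -/
structure IsNeumannSolution {n : ℕ} {p : ℝ≥0∞} [Fact (1 ≤ p)] {Ω : Set (Eu n)}
    {Ψ : Eu n → Eu n → Eu n} (T : ℝ) (u₀ : LpOn p Ω) (U₀ : LpQ p Ω Ψ)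
    (u : ℝ → LpOn p Ω) (U : ℝ → LpQ p Ω Ψ) : Prop where
  initial : u 0 = u₀ ∧ U 0 = U₀
  evolution : ∃ V : ℝ → LpBochner p Ω (LpOn p (unitBall n)),
    (∀ t ∈ Icc 0 T, IsPullback (U t) (V t)) ∧
    ContinuousOn (fun t => (u t, V t)) (Icc 0 T) ∧
    ∀ t ∈ Ioo 0 T, ∃ f F q, IsNeumannOperator Ψ (u t) (V t) f F q ∧
      HasDerivAt (fun s => (u s, V s)) ((q, 0) - (f, F)) t

/-- The total mass `S(u, U) = ∫_Ω u + ∫_Ω ∫_B √|g| Φ^* U`. -/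
def totalMass {n : ℕ} {p : ℝ≥0∞} [Fact (1 ≤ p)] {Ω : Set (Eu n)} {Ψ : Eu n → Eu n → Eu n}
    (u : LpOn p Ω) (U : LpQ p Ω Ψ) : ℝ :=
  (∫ x in Ω, u x) + ∫ x in Ω, ∫ y in unitBall n, sqrtG Ψ x y * U (cellMap Ψ (x, y))

end Matched

end

/-!
Mass is conserved because the total mass is a bounded linear functional `L` of the pair `(u, V)`,
`V = Φ^* U`, that vanishes on the right-hand side `(q(U), 0) - 𝐀^N (u, U)` of the evolution equation
(`exists_totalMass_functional`). So `t ↦ L (u t, V t)` is continuous on `[0, T]` with zero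
derivative inside, and the mean value theorem makes it constant. No regularity theory is needed.

That `L` vanishes there consists of two instances of Gauss' theorem.

* In the cells, `∫_B √|g| 𝒜_x v = q`, the mass lost through the sphere
  (`integral_sqrtG_laplaceBeltrami`). On the unit ball, Gauss' theorem holds with the exact surface
  measure: the weak formulation is tested with radial cutoff functions, and in polar coordinates
  their derivatives are an approximate identity at radius one (`integral_unitBall_weakPartial`). The
  coefficients `√|g| g^{ij}` are smooth up to the sphere, so the theorem extends to them times a
  Sobolev function with a trace (`integral_weakPartial_mul_eq_flux`).
* In the domain, `∫_Ω Δu = 0` if `∂_ν u = 0` (`integral_laplacian_eq_zero`). Since the boundary flux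
  is zero, a bound is enough: near the boundary, where `Ω` is `ρ < 0`, the integral of a divergence
  `div f` is at most a constant times `∫ |f · ∇ρ|` over the boundary, with respect to Hausdorff
  measure (`exists_integral_div_le`). It comes from cutoff functions of `k ρ`, whose gradients
  `∼ k ∇ρ` live in the layers `|ρ| ≤ 1 / k`. The values of `ρ` and all coordinates but one are
  bi-Lipschitz coordinates there, so that by Fubini's theorem the layer integrals are controlled in
  the limit by Lebesgue measure on the projected boundary, hence by Hausdorff measure
  (`limsup_layer_le`). The bound is applied to the smooth fields that define the trace of `∇u`.

Boundedness of `L` needs that `√|g|` is bounded and jointly measurable on `Ω × B`; both hold since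
`Φ` is Lipschitz continuous (`IsCellGeometry.exists_measurable_sqrtG`).
-/

noncomputable section

namespace Matched

/-! ### Calculus of weak derivatives -/

lemma continuous_fderiv_apply {n : ℕ} {φ : Eu n → ℝ} (hφ : ContDiff ℝ ∞ φ) (v : Eu n) :
    Continuous fun y => fderiv ℝ φ y v :=
  (hφ.continuous_fderiv (by simp)).clm_apply continuous_const

lemma HasWeakPartial.of_contDiff {n : ℕ} {O : Set (Eu n)} {φ : Eu n → ℝ} (i : Fin n)
    (hφ : ContDiff ℝ ∞ φ) : HasWeakPartial O i φ (fun y => fderiv ℝ φ y (basisVec i)) := by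
  refine ⟨hφ.continuous.locallyIntegrable.locallyIntegrableOn O,
    (continuous_fderiv_apply hφ _).locallyIntegrable.locallyIntegrableOn O, fun ψ h1 h2 h3 => ?_⟩
  have e : ∀ y ∉ O, ψ y = 0 := fun y hy => image_eq_zero_of_notMem_tsupport fun h => hy (h3 h)
  have e' : ∀ y ∉ O, fderiv ℝ ψ y (basisVec i) = 0 := fun y hy => by
    rw [image_eq_zero_of_notMem_tsupport (f := fderiv ℝ ψ)
      fun h => hy (h3 (tsupport_fderiv_subset ℝ h))]
    rfl
  rw [setIntegral_eq_integral_of_forall_compl_eq_zero (fun y hy => by rw [e' y hy, mul_zero]),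
    setIntegral_eq_integral_of_forall_compl_eq_zero (fun y hy => by rw [e y hy, mul_zero])]
  refine integral_mul_fderiv_eq_neg_fderiv_mul_of_integrable ?_ ?_ ?_
    (fun x _ => hφ.differentiable (by simp) x) (fun x _ => h1.differentiable (by simp) x)
  · exact ((continuous_fderiv_apply hφ _).mul h1.continuous).integrable_of_hasCompactSupport
      h2.mul_left
  · exact (hφ.continuous.mul (continuous_fderiv_apply h1 _)).integrable_of_hasCompactSupport
      (h2.fderiv_apply (𝕜 := ℝ) _).mul_left
  · exact (hφ.continuous.mul h1.continuous).integrable_of_hasCompactSupport h2.mul_left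

lemma contDiff_of_contDiffAt_tsupport {n : ℕ} {f : Eu n → ℝ}
    (h : ∀ x ∈ tsupport f, ContDiffAt ℝ ∞ f x) : ContDiff ℝ ∞ f := by
  refine contDiff_iff_contDiffAt.2 fun x => ?_
  by_cases hx : x ∈ tsupport f
  · exact h x hx
  · exact contDiffAt_const.congr_of_eventuallyEq (notMem_tsupport_iff_eventuallyEq.1 hx)

lemma HasWeakPartial.mul_contDiffOn {n : ℕ} {O : Set (Eu n)} (hO : IsOpen O) {i : Fin n}
    {f h a : Eu n → ℝ} (H : HasWeakPartial O i f h) (ha : ContDiffOn ℝ ∞ a O) :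
    HasWeakPartial O i (fun y => a y * f y)
      (fun y => a y * h y + fderiv ℝ a y (basisVec i) * f y) := by
  have hda : ContinuousOn (fun y => fderiv ℝ a y (basisVec i)) O :=
    (ha.continuousOn_fderiv_of_isOpen hO (by simp)).clm_apply continuousOn_const
  have L : ∀ {b g : Eu n → ℝ}, ContinuousOn b O → LocallyIntegrableOn g O volume →
      LocallyIntegrableOn (fun y => b y * g y) O volume := fun hb hg =>
    hg.continuousOn_mul hb hO.isLocallyClosed
  have L2 := L ha.continuousOn H.2.1
  have L3 := L hda H.1
  refine ⟨L ha.continuousOn H.1, L2.add L3, fun ψ h1 h2 h3 => ?_⟩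
  have hat : ∀ x ∈ tsupport ψ, ContDiffAt ℝ ∞ a x := fun x hx =>
    ha.contDiffAt (hO.mem_nhds (h3 hx))
  have hsm : ContDiff ℝ ∞ (fun y => a y * ψ y) := by
    refine contDiff_of_contDiffAt_tsupport fun x hx => ?_
    exact (hat x (tsupport_mul_subset_right hx)).mul h1.contDiffAt
  have key := H.2.2 (fun y => a y * ψ y) hsm h2.mul_left
    ((tsupport_mul_subset_right).trans h3)
  have hd : ∀ y ∈ O, fderiv ℝ (fun y => a y * ψ y) y (basisVec i)
      = a y * fderiv ℝ ψ y (basisVec i) + fderiv ℝ a y (basisVec i) * ψ y := fun y hy => by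
    have := fderiv_fun_mul ((ha.contDiffAt (hO.mem_nhds hy)).differentiableAt (by simp))
      (h1.differentiable (by simp) y)
    rw [this]
    simp [mul_comm]
  rw [setIntegral_congr_fun (g := fun y => a y * f y * fderiv ℝ ψ y (basisVec i) +
      fderiv ℝ a y (basisVec i) * f y * ψ y) hO.measurableSet
      (fun y hy => by simp only [hd y hy]; ring),
    integral_add (integrableOn_mul_test_deriv _ (L ha.continuousOn H.1) h1 h2 h3)
      (integrableOn_mul_test L3 h1.continuous h2 h3)] at key
  simp only [add_mul]
  rw [integral_add (integrableOn_mul_test L2 h1.continuous h2 h3)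
    (integrableOn_mul_test L3 h1.continuous h2 h3)]
  have e : ∫ y in O, h y * (a y * ψ y) = ∫ y in O, a y * h y * ψ y := by
    congr 1; ext y; ring
  rw [e] at key
  linarith

lemma HasWeakPartial.ae_unique {n : ℕ} {O : Set (Eu n)} (hO : IsOpen O) {i : Fin n}
    {f h h' : Eu n → ℝ} (H : HasWeakPartial O i f h) (H' : HasWeakPartial O i f h') :
    h =ᵐ[volume.restrict O] h' := by
  have := hO.ae_eq_zero_of_integral_contDiff_smul_eq_zero (μ := volume) (f := h - h')
    (H.2.1.sub H'.2.1) (fun g g1 g2 g3 => by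
      have e : ∫ y, g y • (h - h') y = ∫ y in O, g y • (h - h') y :=
        (setIntegral_eq_integral_of_forall_compl_eq_zero (fun y hy => by
          rw [image_eq_zero_of_notMem_tsupport fun h => hy (g3 h), zero_smul])).symm
      rw [e]
      have e1 := H.2.2 g g1 g2 g3
      rw [H'.2.2 g g1 g2 g3, neg_inj] at e1
      have : ∀ y, g y • (h - h') y = h y * g y - h' y * g y := fun y => by
        simp only [smul_eq_mul, Pi.sub_apply]; ring
      simp only [this]
      rw [integral_sub (integrableOn_mul_test H.2.1 g1.continuous g2 g3)
        (integrableOn_mul_test H'.2.1 g1.continuous g2 g3), e1, sub_self])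
  rw [Filter.EventuallyEq, ae_restrict_iff' hO.measurableSet]
  filter_upwards [this] with y hy hyO
  exact sub_eq_zero.1 (hy hyO)

/-! ### The divergence theorem on the unit ball -/

/-- The change of variables `y = r s` to polar coordinates, away from the origin. -/
lemma integrable_polar {n : ℕ} {F : Eu n → ℝ} (hF : Integrable F volume) :
    Integrable (fun z : sphere (0 : Eu n) 1 × Ioi (0 : ℝ) => F (z.2.1 • z.1.1))
      ((volume : Measure (Eu n)).toSphere.prod
        (.volumeIoiPow (Module.finrank ℝ (Eu n) - 1))) ∧
    ∫ z : sphere (0 : Eu n) 1 × Ioi (0 : ℝ), F (z.2.1 • z.1.1)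
      ∂((volume : Measure (Eu n)).toSphere.prod
        (.volumeIoiPow (Module.finrank ℝ (Eu n) - 1))) = ∫ y in {0}ᶜ, F y := by
  have hm := (volume : Measure (Eu n)).measurePreserving_homeomorphUnitSphereProd
  have hemb := (homeomorphUnitSphereProd (Eu n)).measurableEmbedding
  have e : ∀ y : ({0}ᶜ : Set (Eu n)), (fun z : sphere (0 : Eu n) 1 × Ioi (0 : ℝ) =>
      F (z.2.1 • z.1.1)) (homeomorphUnitSphereProd (Eu n) y) = F y := fun y => by
    conv_rhs => rw [← (homeomorphUnitSphereProd (Eu n)).symm_apply_apply y]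
    rfl
  constructor
  · rw [← hm.integrable_comp_emb hemb]
    have h1 : Integrable (F ∘ ((↑) : ({0}ᶜ : Set (Eu n)) → Eu n))
        ((volume : Measure (Eu n)).comap (↑)) := by
      rw [← integrableOn_iff_comap_subtypeVal (measurableSet_singleton _).compl]
      exact hF.integrableOn
    exact h1.congr (ae_of_all _ fun y => (e y).symm)
  · rw [← hm.integral_comp hemb]
    simp only [e]
    exact integral_subtype_comap (measurableSet_singleton _).compl F

/-- Integration over the unit ball in polar coordinates. -/
lemma setIntegral_unitBall_polar {n : ℕ} (hn : 1 ≤ n) {f : Eu n → ℝ}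
    (hf : IntegrableOn f (unitBall n)) :
    Integrable (fun s : sphere (0 : Eu n) 1 => ∫ r in Ioo (0 : ℝ) 1, r ^ (n - 1) * f (r • s.1))
      (volume : Measure (Eu n)).toSphere ∧
    ∫ y in unitBall n, f y = ∫ s : sphere (0 : Eu n) 1, ∫ r in Ioo (0 : ℝ) 1,
      r ^ (n - 1) * f (r • s.1) ∂volume ∂(volume : Measure (Eu n)).toSphere := by
  have : Nontrivial (Eu n) := by
    have : Nonempty (Fin n) := ⟨⟨0, hn⟩⟩
    infer_instance
  have hB : MeasurableSet (unitBall n) := measurableSet_ball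
  have hF : Integrable ((unitBall n).indicator f) volume :=
    (integrable_indicator_iff hB).2 hf
  obtain ⟨h1, h2⟩ := integrable_polar hF
  have hfr : Module.finrank ℝ (Eu n) - 1 = n - 1 := by simp
  rw [hfr] at h1 h2
  have e : ∀ s : sphere (0 : Eu n) 1, ∫ r : Ioi (0 : ℝ), (unitBall n).indicator f (r.1 • s.1)
      ∂(.volumeIoiPow (n - 1)) = ∫ r in Ioo (0 : ℝ) 1, r ^ (n - 1) * f (r • s.1) := fun s => by
    simp only [Measure.volumeIoiPow, ENNReal.ofReal]
    rw [integral_withDensity_eq_integral_smul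
        ((measurable_subtype_coe.pow_const _).real_toNNReal),
      integral_subtype_comap measurableSet_Ioi
        fun a : ℝ ↦ Real.toNNReal (a ^ (n - 1)) • (unitBall n).indicator f (a • s.1),
      ← integral_indicator measurableSet_Ioi, ← integral_indicator measurableSet_Ioo]
    congr 1
    ext r
    by_cases h0 : 0 < r
    · have hs : ‖s.1‖ = 1 := by simp
      by_cases hr1 : r < 1
      · have : r • s.1 ∈ unitBall n := by
          simp [unitBall, norm_smul, hs, abs_of_pos h0, hr1]
        simp [indicator, h0, hr1, this, NNReal.smul_def, h0.le]
      · have : r • s.1 ∉ unitBall n := by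
          simpa [unitBall, norm_smul, hs, abs_of_pos h0] using hr1
        simp [indicator, h0, hr1, this]
    · simp [indicator, h0]
  constructor
  · exact h1.integral_prod_left.congr (ae_of_all _ e)
  · rw [restrict_compl_singleton, integral_indicator hB, integral_prod _ h1] at h2
    rw [← h2]
    exact integral_congr_ae (ae_of_all _ e)

/-- The radial cutoff function, equal to one where `2 / k ≤ 1 - ‖y‖²` and to zero where
`1 - ‖y‖² ≤ 1 / k`. -/
def radialCutoff {n : ℕ} (k : ℕ) (y : Eu n) : ℝ := Real.smoothTransition (k * (1 - ‖y‖ ^ 2) - 1)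

lemma deriv_smoothTransition_eq_zero {t : ℝ} (ht : t < 0 ∨ 1 < t) :
    deriv Real.smoothTransition t = 0 := by
  have : Real.smoothTransition =ᶠ[𝓝 t] fun _ => Real.smoothTransition t := by
    rcases ht with ht | ht
    · filter_upwards [Iio_mem_nhds ht] with s hs
      rw [Real.smoothTransition.zero_of_nonpos (le_of_lt hs),
        Real.smoothTransition.zero_of_nonpos ht.le]
    · filter_upwards [Ioi_mem_nhds ht] with s hs
      rw [Real.smoothTransition.one_of_one_le (le_of_lt hs),
        Real.smoothTransition.one_of_one_le ht.le]
  rw [this.deriv_eq, deriv_const]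

lemma deriv_smoothTransition_nonneg (t : ℝ) : 0 ≤ deriv Real.smoothTransition t :=
  Real.smoothTransition.monotone.deriv_nonneg

lemma continuous_deriv_smoothTransition : Continuous (deriv Real.smoothTransition) :=
  (Real.smoothTransition.contDiff (n := 1)).continuous_deriv le_rfl

lemma hasDerivAt_smoothTransition (t : ℝ) :
    HasDerivAt Real.smoothTransition (deriv Real.smoothTransition t) t :=
  ((Real.smoothTransition.contDiff (n := 1)).differentiable (by simp) t).hasDerivAt

lemma contDiff_radialCutoff {n : ℕ} (k : ℕ) : ContDiff ℝ ∞ (radialCutoff (n := n) k) :=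
  Real.smoothTransition.contDiff.comp
    ((contDiff_const.mul (contDiff_const.sub (contDiff_norm_sq ℝ))).sub contDiff_const)

lemma fderiv_radialCutoff {n : ℕ} (k : ℕ) (y : Eu n) (i : Fin n) :
    fderiv ℝ (radialCutoff k) y (basisVec i)
      = -(2 * k * deriv Real.smoothTransition (k * (1 - ‖y‖ ^ 2) - 1) * y i) := by
  have h1 : HasFDerivAt (fun y : Eu n => ‖y‖ ^ 2) (2 • (innerSL ℝ y)) y :=
    (hasStrictFDerivAt_norm_sq y).hasFDerivAt
  have h2 := (((h1.const_sub 1).const_mul (k : ℝ)).sub_const 1)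
  have h3 := (hasDerivAt_smoothTransition _).comp_hasFDerivAt y h2
  have : radialCutoff (n := n) k = Real.smoothTransition ∘ fun y => k * (1 - ‖y‖ ^ 2) - 1 := rfl
  rw [this, h3.fderiv]
  simp [basisVec, EuclideanSpace.inner_single_right]
  ring

lemma tsupport_radialCutoff_subset {n : ℕ} {k : ℕ} :
    tsupport (radialCutoff (n := n) k) ⊆ {y | 1 ≤ k * (1 - ‖y‖ ^ 2)} := by
  refine closure_minimal (fun y hy => ?_) (isClosed_le continuous_const (by fun_prop))
  by_contra h
  simp only [mem_ofPred_eq, not_le] at h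
  exact hy (Real.smoothTransition.zero_of_nonpos (by linarith))

lemma tsupport_radialCutoff_subset_unitBall {n : ℕ} {k : ℕ} (hk : 1 ≤ k) :
    tsupport (radialCutoff (n := n) k) ⊆ unitBall n := by
  intro y hy
  have h := tsupport_radialCutoff_subset hy
  simp only [mem_ofPred_eq] at h
  have hk' : (1 : ℝ) ≤ k := by exact_mod_cast hk
  have : 0 < 1 - ‖y‖ ^ 2 := by
    by_contra h0
    nlinarith
  rw [unitBall, mem_ball_zero_iff]
  nlinarith [norm_nonneg y]

/-- The radial kernel that arises from the derivative of the cutoff function. It is an approximate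
identity at the endpoint `r = 1` of `(0, 1)`. -/
def peak (k : ℕ) (r : ℝ) : ℝ := 2 * k * r * deriv Real.smoothTransition (k * (1 - r ^ 2) - 1)

lemma peak_nonneg {k : ℕ} {r : ℝ} (hr : 0 ≤ r) : 0 ≤ peak k r := by
  have := deriv_smoothTransition_nonneg (k * (1 - r ^ 2) - 1)
  unfold peak
  positivity

lemma continuous_peak (k : ℕ) : Continuous (peak k) := by
  unfold peak
  have := continuous_deriv_smoothTransition
  fun_prop

lemma integral_peak {k : ℕ} (hk : 2 ≤ k) : ∫ r in Ioo (0 : ℝ) 1, peak k r = 1 := by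
  have hk' : (2 : ℝ) ≤ k := by exact_mod_cast hk
  rw [← integral_Ioc_eq_integral_Ioo, ← intervalIntegral.integral_of_le zero_le_one]
  have := intervalIntegral.integral_eq_sub_of_hasDerivAt (a := 0) (b := 1)
    (f := fun r : ℝ => -Real.smoothTransition (k * (1 - r ^ 2) - 1)) (f' := peak k)
    (fun r _ => by
      have h1 : HasDerivAt (fun r : ℝ => (k : ℝ) * (1 - r ^ 2) - 1) (-(2 * k * r)) r := by
        have := (((hasDerivAt_pow 2 r).const_sub 1).const_mul (k : ℝ)).sub_const 1
        refine this.congr_deriv ?_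
        simp; ring
      have := ((hasDerivAt_smoothTransition _).comp r h1).neg
      refine this.congr_deriv ?_
      unfold peak; ring)
    ((continuous_peak k).intervalIntegrable _ _)
  rw [this, Real.smoothTransition.zero_of_nonpos (by norm_num),
    Real.smoothTransition.one_of_one_le (by norm_num; linarith)]
  norm_num

lemma tendsto_integral_peak_mul {g : ℝ → ℝ} (hg : ContinuousOn g (Icc 0 1)) :
    Tendsto (fun k => ∫ r in Ioo (0 : ℝ) 1, peak k r * g r) atTop (𝓝 (g 1)) := by
  have := tendsto_setIntegral_peak_smul_of_integrableOn_of_tendsto (μ := volume) (l := atTop)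
    (φ := peak) (g := g) (x₀ := 1) (a := g 1) (s := Ioo (0 : ℝ) 1) (t := Ioo (0 : ℝ) 1)
    measurableSet_Ioo measurableSet_Ioo subset_rfl self_mem_nhdsWithin (by simp)
    (Eventually.of_forall fun k x hx => peak_nonneg hx.1.le) ?_ ?_
    (Eventually.of_forall fun k => (continuous_peak k).aestronglyMeasurable)
    ((hg.integrableOn_Icc).mono_set Ioo_subset_Icc_self)
    ((hg 1 (by simp)).mono_left (nhdsWithin_mono _ Ioo_subset_Icc_self))
  · simpa only [smul_eq_mul] using this
  · intro u hu h1
    obtain ⟨δ, hδ, hb⟩ := Metric.isOpen_iff.1 hu 1 h1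
    refine fun w hw => ?_
    have hlim : Tendsto (fun k : ℕ => (k : ℝ) * δ) atTop atTop :=
      tendsto_natCast_atTop_atTop.atTop_mul_const hδ
    filter_upwards [hlim.eventually_gt_atTop 2] with k hk r hr
    have hr1 : r ≤ 1 - δ := by
      by_contra hc
      refine hr.2 (hb ?_)
      rw [mem_ball, Real.dist_eq, abs_lt]
      constructor <;> linarith [hr.1.2]
    have : peak k r = 0 := by
      unfold peak
      rw [deriv_smoothTransition_eq_zero, mul_zero]
      right
      have h2 : δ ≤ 1 - r ^ 2 := by nlinarith [hr.1.1, hr.1.2]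
      have h3 : (k : ℝ) * δ ≤ k * (1 - r ^ 2) := by gcongr
      linarith
    rw [this]
    exact mem_uniformity_of_eq hw rfl
  · refine tendsto_const_nhds.congr' ?_
    filter_upwards [eventually_ge_atTop 2] with k hk
    exact (integral_peak hk).symm

/-- **Gauss' theorem on the unit ball**, for a continuous function on the closed ball with an
integrable weak partial derivative. It is the weak formulation for the test functions
`radialCutoff k`, in the limit `k → ∞`. -/
lemma integral_unitBall_weakPartial {n : ℕ} (hn : 1 ≤ n) {i : Fin n} {G D : Eu n → ℝ}
    (hG : ContinuousOn G (closedBall 0 1)) (H : HasWeakPartial (unitBall n) i G D)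
    (hD : IntegrableOn D (unitBall n)) :
    ∫ y in unitBall n, D y = ∫ s, G s * s i ∂sphereMeasure n := by
  -- the integral of `D` is the limit of its integrals against the cutoff functions
  have hleft : Tendsto (fun k : ℕ => ∫ y in unitBall n, D y * radialCutoff k y) atTop
      (𝓝 (∫ y in unitBall n, D y)) := by
    refine tendsto_integral_of_dominated_convergence (fun y => ‖D y‖) (fun k => ?_) hD.norm
      (fun k => ae_of_all _ fun y => ?_) ?_
    · exact hD.aestronglyMeasurable.mul (contDiff_radialCutoff k).continuous.aestronglyMeasurable
    · rw [norm_mul]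
      refine mul_le_of_le_one_right (norm_nonneg _) ?_
      rw [radialCutoff, Real.norm_of_nonneg (Real.smoothTransition.nonneg _)]
      exact Real.smoothTransition.le_one _
    · filter_upwards [ae_restrict_mem measurableSet_ball] with y hy
      rw [unitBall, mem_ball_zero_iff] at hy
      have hpos : 0 < 1 - ‖y‖ ^ 2 := by nlinarith [norm_nonneg y]
      refine tendsto_const_nhds.congr' ?_
      filter_upwards [(tendsto_natCast_atTop_atTop.atTop_mul_const hpos).eventually_ge_atTop 2]
        with k hk
      rw [radialCutoff, Real.smoothTransition.one_of_one_le (by linarith), mul_one]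
  -- a bound for `G` on the closed ball
  obtain ⟨M, hM⟩ := (isCompact_closedBall (0 : Eu n) 1).exists_bound_of_continuousOn hG
  have hint : ∀ k : ℕ, IntegrableOn
      (fun y => -(G y * fderiv ℝ (radialCutoff k) y (basisVec i))) (unitBall n) := fun k =>
    (((hG.mul (continuous_fderiv_apply (contDiff_radialCutoff k)
      _).continuousOn).integrableOn_compact (isCompact_closedBall _ _)).mono_set
      ball_subset_closedBall).neg
  have hpolar : ∀ (k : ℕ) (s : sphere (0 : Eu n) 1),
      ∫ r in Ioo (0 : ℝ) 1, r ^ (n - 1) *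
        -(G (r • s.1) * fderiv ℝ (radialCutoff k) (r • s.1) (basisVec i))
      = ∫ r in Ioo (0 : ℝ) 1, peak k r * (r ^ (n - 1) * G (r • s.1) * s.1 i) := fun k s => by
    refine setIntegral_congr_fun measurableSet_Ioo fun r hr => ?_
    have hs : ‖s.1‖ = 1 := by simp
    have : ‖r • s.1‖ = r := by rw [norm_smul, hs, mul_one, Real.norm_of_nonneg hr.1.le]
    simp only [fderiv_radialCutoff, this, peak, PiLp.smul_apply, smul_eq_mul]
    ring
  have hdef : ∀ k : ℕ, 1 ≤ k → ∫ y in unitBall n, D y * radialCutoff k y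
      = ∫ s : sphere (0 : Eu n) 1, (∫ r in Ioo (0 : ℝ) 1, peak k r * (r ^ (n - 1) * G (r • s.1)
        * s.1 i)) ∂(volume : Measure (Eu n)).toSphere := fun k hk => by
    have h1 := H.2.2 (radialCutoff k) (contDiff_radialCutoff k)
      (HasCompactSupport.of_support_subset_isCompact (isCompact_closedBall (0 : Eu n) 1)
        ((subset_tsupport _).trans ((tsupport_radialCutoff_subset_unitBall hk).trans
          ball_subset_closedBall))) (tsupport_radialCutoff_subset_unitBall hk)
    have h2 := (setIntegral_unitBall_polar hn (hint k)).2
    rw [integral_neg, h1, neg_neg] at h2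
    rw [h2]
    exact integral_congr_ae (ae_of_all _ (hpolar k))
  have hmeas : ∀ k : ℕ, AEStronglyMeasurable (fun s : sphere (0 : Eu n) 1 =>
      ∫ r in Ioo (0 : ℝ) 1, peak k r * (r ^ (n - 1) * G (r • s.1) * s.1 i))
      (volume : Measure (Eu n)).toSphere := fun k =>
    (setIntegral_unitBall_polar hn (hint k)).1.aestronglyMeasurable.congr
      (ae_of_all _ (hpolar k))
  have hmem : ∀ (s : sphere (0 : Eu n) 1) (r : ℝ), r ∈ Icc (0 : ℝ) 1 →
      r • s.1 ∈ closedBall (0 : Eu n) 1 := fun s r hr => by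
    have hs : ‖s.1‖ = 1 := by simp
    rw [mem_closedBall_zero_iff, norm_smul, hs, mul_one, Real.norm_of_nonneg hr.1]
    exact hr.2
  have hright : Tendsto (fun k : ℕ => ∫ s : sphere (0 : Eu n) 1, (∫ r in Ioo (0 : ℝ) 1,
      peak k r * (r ^ (n - 1) * G (r • s.1) * s.1 i)) ∂(volume : Measure (Eu n)).toSphere) atTop
      (𝓝 (∫ s : sphere (0 : Eu n) 1, G s.1 * s.1 i ∂(volume : Measure (Eu n)).toSphere)) := by
    refine tendsto_integral_filter_of_dominated_convergence (fun _ => M) ?_ ?_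
      (integrable_const _) (ae_of_all _ fun s => ?_)
    · exact Eventually.of_forall hmeas
    · filter_upwards [eventually_ge_atTop 2] with k hk
      refine ae_of_all _ fun s => ?_
      have hs : ‖s.1‖ = 1 := by simp
      have hsi : |s.1 i| ≤ 1 := by
        have := PiLp.norm_apply_le s.1 i
        rwa [hs, Real.norm_eq_abs] at this
      calc _ ≤ ∫ r in Ioo (0 : ℝ) 1, peak k r * M := by
            refine norm_integral_le_of_norm_le ?_ ?_
            · exact ((((continuous_peak k).mul continuous_const).continuousOn
                (s := Icc 0 1)).integrableOn_Icc).mono_set Ioo_subset_Icc_self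
            · filter_upwards [ae_restrict_mem measurableSet_Ioo] with r hr
              rw [norm_mul, Real.norm_of_nonneg (peak_nonneg hr.1.le)]
              refine mul_le_mul_of_nonneg_left ?_ (peak_nonneg hr.1.le)
              have hM' := hM _ (hmem s r ⟨hr.1.le, hr.2.le⟩)
              rw [norm_mul, norm_mul, Real.norm_of_nonneg (pow_nonneg hr.1.le _)]
              have h1 : r ^ (n - 1) ≤ 1 := pow_le_one₀ hr.1.le hr.2.le
              have h0 : 0 ≤ r ^ (n - 1) := pow_nonneg hr.1.le _
              calc r ^ (n - 1) * ‖G (r • s.1)‖ * ‖s.1 i‖ ≤ 1 * M * 1 := by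
                    gcongr
                    · exact mul_nonneg zero_le_one ((norm_nonneg _).trans hM')
                    · exact hsi
                _ = M := by ring
        _ = M := by rw [integral_mul_const, integral_peak hk, one_mul]
    · have := tendsto_integral_peak_mul (g := fun r => r ^ (n - 1) * G (r • s.1) * s.1 i) (by
        refine ((continuous_pow _).continuousOn.mul (hG.comp (by fun_prop) (hmem s))).mul
          continuousOn_const)
      simpa using this
  have e : ∫ s, G s * s i ∂sphereMeasure n
      = ∫ s : sphere (0 : Eu n) 1, G s.1 * s.1 i ∂(volume : Measure (Eu n)).toSphere := by
    rw [sphereMeasure, (MeasurableEmbedding.subtype_coe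
      isClosed_sphere.measurableSet).integral_map]
  rw [e]
  refine tendsto_nhds_unique hleft (hright.congr' ?_)
  filter_upwards [eventually_ge_atTop 1] with k hk using (hdef k hk).symm

/-! ### Fluxes through the unit sphere -/

instance {n : ℕ} : IsFiniteMeasure (sphereMeasure n) := by
  unfold sphereMeasure; infer_instance

lemma ae_sphereMeasure_mem {n : ℕ} : ∀ᵐ s ∂sphereMeasure n, s ∈ closedBall (0 : Eu n) 1 := by
  rw [sphereMeasure]
  refine (ae_map_iff measurable_subtype_coe.aemeasurable
    (isClosed_closedBall (x := (0 : Eu n)) (ε := 1)).measurableSet).2 ?_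
  exact ae_of_all _ fun s => sphere_subset_closedBall s.2

instance {n : ℕ} : IsFiniteMeasure ((volume : Measure (Eu n)).restrict (unitBall n)) :=
  ⟨by rw [Measure.restrict_apply_univ]; exact measure_ball_lt_top⟩

lemma aestronglyMeasurable_of_continuousOn_of_ae_mem {n : ℕ} {g : Eu n → ℝ} {K : Set (Eu n)}
    {μ : Measure (Eu n)} (hg : ContinuousOn g K) (hK : IsCompact K) (hμ : ∀ᵐ x ∂μ, x ∈ K) :
    AEStronglyMeasurable g μ := by
  rw [← Measure.restrict_eq_self_of_ae_mem hμ]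
  exact hg.aestronglyMeasurable hK.measurableSet

lemma integrable_continuousOn_mul {n : ℕ} {g f : Eu n → ℝ} {K : Set (Eu n)}
    {μ : Measure (Eu n)} (hg : ContinuousOn g K) (hK : IsCompact K) (hμ : ∀ᵐ x ∂μ, x ∈ K)
    (hf : Integrable f μ) : Integrable (fun x => g x * f x) μ := by
  obtain ⟨M, hM⟩ := hK.exists_bound_of_continuousOn hg
  refine hf.bdd_mul (aestronglyMeasurable_of_continuousOn_of_ae_mem hg hK hμ) (c := M) ?_
  filter_upwards [hμ] with x hx using hM x hx

lemma measure_univ_rpow_ne_top {α : Type*} [MeasurableSpace α] (μ : Measure α) [IsFiniteMeasure μ]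
    {p : ℝ≥0∞} (hp : 1 ≤ p) : μ univ ^ (1 / (1 : ℝ≥0∞).toReal - 1 / p.toReal) ≠ ⊤ := by
  refine ENNReal.rpow_ne_top_of_nonneg ?_ (measure_ne_top _ _)
  rw [sub_nonneg]
  rcases eq_or_ne p ⊤ with rfl | hpt
  · simp
  · have : 1 ≤ p.toReal := by
      rw [← ENNReal.toReal_one]; exact ENNReal.toReal_mono hpt hp
    simpa using inv_le_one_of_one_le₀ this

lemma tendsto_eLpNorm_one_of_tendsto_eLpNorm {α : Type*} [MeasurableSpace α] {μ : Measure α}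
    [IsFiniteMeasure μ] {p : ℝ≥0∞} (hp : 1 ≤ p) {F : ℕ → α → ℝ}
    (hF : ∀ k, AEStronglyMeasurable (F k) μ)
    (h : Tendsto (fun k => eLpNorm (F k) p μ) atTop (𝓝 0)) :
    Tendsto (fun k => eLpNorm (F k) 1 μ) atTop (𝓝 0) := by
  have h1 := ENNReal.Tendsto.mul_const h (Or.inr (measure_univ_rpow_ne_top μ hp))
  rw [zero_mul] at h1
  exact tendsto_of_tendsto_of_tendsto_of_le_of_le tendsto_const_nhds h1 (fun _ => zero_le)
    fun k => eLpNorm_le_eLpNorm_mul_rpow_measure_univ hp (hF k)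

lemma tendsto_integral_mul_of_tendsto_eLpNorm {n : ℕ} {p : ℝ≥0∞} (hp : 1 ≤ p)
    {μ : Measure (Eu n)} [IsFiniteMeasure μ] {g f : Eu n → ℝ} {φ : ℕ → Eu n → ℝ} {K : Set (Eu n)}
    (hg : ContinuousOn g K) (hK : IsCompact K) (hμ : ∀ᵐ x ∂μ, x ∈ K)
    (hφ : ∀ k, Continuous (φ k)) (hf : MemLp f p μ)
    (h : Tendsto (fun k => eLpNorm (fun x => φ k x - f x) p μ) atTop (𝓝 0)) :
    Tendsto (fun k => ∫ x, g x * φ k x ∂μ) atTop (𝓝 (∫ x, g x * f x ∂μ)) := by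
  obtain ⟨M, hM⟩ := hK.exists_bound_of_continuousOn hg
  have hm : ∀ k, AEStronglyMeasurable (fun x => φ k x - f x) μ := fun k =>
    (hφ k).aestronglyMeasurable.sub hf.aestronglyMeasurable
  refine tendsto_integral_of_L1' _
    (integrable_continuousOn_mul hg hK hμ (hf.integrable hp)).aestronglyMeasurable ?_ ?_
  · filter_upwards [h.eventually_lt_const ENNReal.zero_lt_top] with k hk
    refine integrable_continuousOn_mul hg hK hμ ?_
    have h1 : MemLp (fun x => φ k x - f x) p μ := ⟨hm k, hk⟩
    have := (h1.add hf).integrable hp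
    refine this.congr (ae_of_all _ fun x => ?_)
    simp
  · have h1 := ENNReal.Tendsto.const_mul (a := ENNReal.ofReal M)
      (tendsto_eLpNorm_one_of_tendsto_eLpNorm hp hm h) (Or.inr ENNReal.ofReal_ne_top)
    rw [mul_zero] at h1
    refine tendsto_of_tendsto_of_tendsto_of_le_of_le tendsto_const_nhds h1
      (fun _ => zero_le) fun k => ?_
    refine eLpNorm_le_mul_eLpNorm_of_ae_le_mul (c := M) (g := fun x => φ k x - f x) ?_ 1
    filter_upwards [hμ] with x hx
    rw [Pi.sub_apply, ← mul_sub, norm_mul]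
    exact mul_le_mul_of_nonneg_right (hM x hx) (norm_nonneg _)

lemma integrable_flux {n : ℕ} {p : ℝ≥0∞} (hp : 1 ≤ p) {a τ : Eu n → ℝ} (i : Fin n)
    (ha : ContinuousOn a (closedBall 0 1)) (hτ : MemLp τ p (sphereMeasure n)) :
    Integrable (fun s => a s * τ s * s i) (sphereMeasure n) := by
  have := integrable_continuousOn_mul (g := fun s => a s * s i)
    (ha.mul (by fun_prop)) (isCompact_closedBall _ _)
    ae_sphereMeasure_mem (hτ.integrable hp)
  refine this.congr (ae_of_all _ fun s => ?_)
  ring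

/-- Gauss' theorem for `∂_i (a f)`, where `a` is smooth on the closed ball and `f` is a Sobolev
function with trace `τ`. -/
lemma integral_weakPartial_mul_eq_flux {n : ℕ} (hn : 1 ≤ n) {p : ℝ≥0∞} (hp : 1 ≤ p)
    {f : Eu n → ℝ} {df : Fin n → Eu n → ℝ} {τ a h : Eu n → ℝ} {i : Fin n}
    (hf : MemLp f p (volume.restrict (unitBall n)))
    (hdf : MemLp (df i) p (volume.restrict (unitBall n)))
    (hw : HasWeakPartial (unitBall n) i f (df i))
    (hτ : HasTrace p (unitBall n) (sphereMeasure n) f df τ)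
    (ha : ContDiffOn ℝ ∞ a (closedBall 0 1))
    (hh : HasWeakPartial (unitBall n) i (fun y => a y * f y) h) :
    IntegrableOn h (unitBall n) ∧
      ∫ y in unitBall n, h y = ∫ s, a s * τ s * s i ∂sphereMeasure n := by
  have hO : IsOpen (unitBall n) := isOpen_ball
  have hsub : unitBall n ⊆ closedBall 0 1 := ball_subset_closedBall
  have hu : UniqueDiffOn ℝ (closedBall (0 : Eu n) 1) := by
    refine uniqueDiffOn_convex (convex_closedBall _ _) ?_
    rw [interior_closedBall _ one_ne_zero]
    exact ⟨0, by simp⟩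
  set K := closedBall (0 : Eu n) 1 with hKdef
  have hK : IsCompact K := isCompact_closedBall _ _
  have hμ : ∀ᵐ x ∂volume.restrict (unitBall n), x ∈ K := by
    filter_upwards [ae_restrict_mem hO.measurableSet] with x hx using hsub hx
  -- the derivative of `a` extends continuously to the closed ball
  set b : Eu n → ℝ := fun y => fderivWithin ℝ a K y (basisVec i) with hb
  have hbc : ContinuousOn b K :=
    (ha.continuousOn_fderivWithin hu (by simp)).clm_apply continuousOn_const
  have hba : ∀ y ∈ unitBall n, fderiv ℝ a y (basisVec i) = b y := fun y hy => by
    rw [hb]; dsimp only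
    rw [fderivWithin_of_mem_nhds (mem_of_superset (hO.mem_nhds hy) hsub)]
  have haO : ContDiffOn ℝ ∞ a (unitBall n) := ha.mono hsub
  have hprod : ∀ {g dg : Eu n → ℝ}, HasWeakPartial (unitBall n) i g dg →
      HasWeakPartial (unitBall n) i (fun y => a y * g y) (fun y => a y * dg y + b y * g y) :=
    fun hg => (hg.mul_contDiffOn hO haO).congr (ae_eq_refl _) (by
      filter_upwards [ae_restrict_mem hO.measurableSet] with y hy
      rw [hba y hy])
  have hint : ∀ {g dg : Eu n → ℝ}, IntegrableOn g (unitBall n) → IntegrableOn dg (unitBall n) →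
      ∫ y in unitBall n, (a y * dg y + b y * g y)
        = (∫ y in unitBall n, a y * dg y) + ∫ y in unitBall n, b y * g y := fun hg hdg =>
    integral_add (integrable_continuousOn_mul ha.continuousOn hK hμ hdg)
      (integrable_continuousOn_mul hbc hK hμ hg)
  have hfi := hf.integrable hp
  have hdfi := hdf.integrable hp
  have hae := hh.ae_unique hO (hprod hw)
  refine ⟨((integrable_continuousOn_mul ha.continuousOn hK hμ hdfi).add
    (integrable_continuousOn_mul hbc hK hμ hfi)).congr hae.symm, ?_⟩
  rw [integral_congr_ae hae, hint hfi hdfi]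
  obtain ⟨hτm, φ, hφ, h1, h2, h3⟩ := hτ
  have hdφ : ∀ k, Continuous fun y => fderiv ℝ (φ k) y (basisVec i) := fun k =>
    continuous_fderiv_apply (hφ k) _
  have hon : ∀ {g : Eu n → ℝ}, Continuous g → IntegrableOn g (unitBall n) := fun hg =>
    (hg.continuousOn.integrableOn_compact hK).mono_set hsub
  -- Gauss' theorem for the smooth approximants
  have hgauss : ∀ k, (∫ y in unitBall n, a y * fderiv ℝ (φ k) y (basisVec i))
      + ∫ y in unitBall n, b y * φ k y = ∫ s, (a s * s i) * φ k s ∂sphereMeasure n := fun k => by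
    rw [← hint (hon (hφ k).continuous) (hon (hdφ k)),
      integral_unitBall_weakPartial hn (ha.continuousOn.mul (hφ k).continuous.continuousOn)
        (hprod (HasWeakPartial.of_contDiff i (hφ k)))
        ((integrable_continuousOn_mul ha.continuousOn hK hμ (hon (hdφ k))).add
          (integrable_continuousOn_mul hbc hK hμ (hon (hφ k).continuous)))]
    congr 1; ext s; simp only [Pi.mul_apply]; ring
  have l1 := (tendsto_integral_mul_of_tendsto_eLpNorm hp ha.continuousOn hK hμ hdφ hdf (h2 i)).add
    (tendsto_integral_mul_of_tendsto_eLpNorm hp hbc hK hμ (fun k => (hφ k).continuous) hf h1)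
  have l2 := tendsto_integral_mul_of_tendsto_eLpNorm (g := fun s => a s * s i) hp
    (ha.continuousOn.mul (by fun_prop)) hK ae_sphereMeasure_mem (fun k => (hφ k).continuous) hτm h3
  rw [tendsto_nhds_unique l1 (by simpa only [hgauss] using l2)]
  congr 1; ext s; ring

/-! ### Integral functionals on Bochner spaces -/

/-- A bounded measurable family of functionals on `X` integrates to a bounded functional on
`L_p(μ, X)`. -/
lemma exists_integral_functional {α X : Type*} [MeasurableSpace α] {μ : Measure α}
    [IsFiniteMeasure μ] [NormedAddCommGroup X] [NormedSpace ℝ X] [SecondCountableTopology X]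
    {p : ℝ≥0∞} [hp : Fact (1 ≤ p)] {C : ℝ} (hC : 0 ≤ C) :
    ∃ M : ℝ, 0 ≤ M ∧ ∀ ℓ : α → X →L[ℝ] ℝ, (∀ v, Measurable fun a => ℓ a v) →
      (∀ a, ‖ℓ a‖ ≤ C) → ∃ L : Lp X p μ →L[ℝ] ℝ, ‖L‖ ≤ M ∧
        ∀ V : Lp X p μ, Integrable (fun a => ℓ a (V a)) μ ∧ L V = ∫ a, ℓ a (V a) ∂μ := by
  set c : ℝ≥0∞ := μ univ ^ (1 / (1 : ℝ≥0∞).toReal - 1 / p.toReal) with hc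
  have hcfin : c ≠ ⊤ := measure_univ_rpow_ne_top μ hp.out
  refine ⟨C * c.toReal, by positivity, fun ℓ hm hb => ?_⟩
  -- `(v, a) ↦ ℓ a v` is a Carathéodory function
  have hmeas : ∀ V : Lp X p μ, AEStronglyMeasurable (fun a => ℓ a (V a)) μ := fun V => by
    borelize X
    have hsm := stronglyMeasurable_uncurry_of_continuous_of_stronglyMeasurable
      (u := fun (v : X) (a : α) => ℓ a v) (fun a => (ℓ a).continuous)
      (fun v => (hm v).stronglyMeasurable)
    exact (hsm.comp_measurable
      ((Lp.stronglyMeasurable V).measurable.prodMk measurable_id)).aestronglyMeasurable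
  have hle : ∀ (V : Lp X p μ) a, ‖ℓ a (V a)‖ ≤ C * ‖V a‖ := fun V a =>
    (ℓ a).le_of_opNorm_le (hb a) _
  have hVint : ∀ V : Lp X p μ, Integrable V μ := fun V => (Lp.memLp V).integrable hp.out
  have hint : ∀ V : Lp X p μ, Integrable (fun a => ℓ a (V a)) μ := fun V =>
    ((hVint V).norm.const_mul C).mono' (hmeas V) (ae_of_all _ (hle V))
  let L₀ : Lp X p μ →ₗ[ℝ] ℝ :=
    { toFun := fun V => ∫ a, ℓ a (V a) ∂μ
      map_add' := fun V W => by
        rw [← integral_add (hint V) (hint W)]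
        refine integral_congr_ae ?_
        filter_upwards [Lp.coeFn_add V W] with a ha
        rw [ha, Pi.add_apply, map_add]
      map_smul' := fun r V => by
        rw [RingHom.id_apply, smul_eq_mul, ← integral_const_mul]
        refine integral_congr_ae ?_
        filter_upwards [Lp.coeFn_smul r V] with a ha
        rw [ha, Pi.smul_apply, map_smul, smul_eq_mul] }
  have hbound : ∀ V, ‖L₀ V‖ ≤ C * c.toReal * ‖V‖ := fun V => by
    have h1 : ∫ a, ‖V a‖ ∂μ ≤ c.toReal * ‖V‖ := by
      rw [integral_norm_eq_lintegral_enorm (Lp.aestronglyMeasurable V),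
        ← eLpNorm_one_eq_lintegral_enorm, Lp.norm_def, ← ENNReal.toReal_mul]
      refine ENNReal.toReal_mono (ENNReal.mul_ne_top hcfin (Lp.memLp V).2.ne) ?_
      rw [mul_comm]
      exact eLpNorm_le_eLpNorm_mul_rpow_measure_univ hp.out (Lp.aestronglyMeasurable V)
    calc ‖∫ a, ℓ a (V a) ∂μ‖ ≤ ∫ a, C * ‖V a‖ ∂μ :=
          norm_integral_le_of_norm_le ((hVint V).norm.const_mul C) (ae_of_all _ (hle V))
      _ = C * ∫ a, ‖V a‖ ∂μ := integral_const_mul _ _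
      _ ≤ C * (c.toReal * ‖V‖) := by gcongr
      _ = _ := by ring
  exact ⟨L₀.mkContinuous _ hbound, L₀.mkContinuous_norm_le (by positivity) _,
    fun V => ⟨hint V, rfl⟩⟩

/-- Integration against a bounded measurable kernel `w(x, y)` is a bounded functional on
`L_p(Ω, L_p(B))`. -/
lemma exists_kernel_functional {n : ℕ} {p : ℝ≥0∞} [hp : Fact (1 ≤ p)] (hp_top : p ≠ ⊤)
    {Ω : Set (Eu n)} [IsFiniteMeasure ((volume : Measure (Eu n)).restrict Ω)]
    {w : Eu n → Eu n → ℝ} (hw : Measurable (Function.uncurry w)) {C : ℝ}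
    (hC : ∀ x y, |w x y| ≤ C) :
    ∃ L : LpBochner p Ω (LpOn p (unitBall n)) →L[ℝ] ℝ, ∀ V : LpBochner p Ω (LpOn p (unitBall n)),
      Integrable (fun x => ∫ y in unitBall n, w x y * V x y) (volume.restrict Ω) ∧
      L V = ∫ x in Ω, ∫ y in unitBall n, w x y * V x y := by
  have : Fact (p ≠ ⊤) := ⟨hp_top⟩
  have hC0 : 0 ≤ C := (abs_nonneg _).trans (hC 0 0)
  obtain ⟨M, hM0, hM⟩ := exists_integral_functional (α := Eu n) (X := ℝ) (p := p)
    (μ := (volume : Measure (Eu n)).restrict (unitBall n)) hC0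
  have hx : ∀ x, ∃ L : LpOn p (unitBall n) →L[ℝ] ℝ, ‖L‖ ≤ M ∧
      ∀ V : LpOn p (unitBall n), Integrable (fun y => w x y * V y) (volume.restrict (unitBall n)) ∧
        L V = ∫ y in unitBall n, w x y * V y := fun x => by
    refine hM (fun y => w x y • ContinuousLinearMap.id ℝ ℝ) (fun v => ?_) (fun y => ?_)
    · exact (hw.comp measurable_prodMk_left).mul_const v
    · rw [norm_smul]
      calc ‖w x y‖ * ‖ContinuousLinearMap.id ℝ ℝ‖ ≤ C * 1 := by
            gcongr
            · exact hC x y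
            · exact ContinuousLinearMap.norm_id_le
        _ = C := mul_one C
  choose ℓ hℓ hℓ' using hx
  obtain ⟨M', -, hM'⟩ := exists_integral_functional (α := Eu n) (X := LpOn p (unitBall n)) (p := p)
    (μ := (volume : Measure (Eu n)).restrict Ω) hM0
  obtain ⟨L, -, hL⟩ := hM' ℓ (fun v => by
    simp only [fun x => (hℓ' x v).2]
    refine StronglyMeasurable.measurable ?_
    refine StronglyMeasurable.integral_prod_right' (f := fun z : Eu n × Eu n => w z.1 z.2 * v z.2) ?_
    exact hw.stronglyMeasurable.mul ((Lp.stronglyMeasurable v).comp_measurable measurable_snd)) hℓ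
  refine ⟨L, fun V => ?_⟩
  have := hL V
  simp only [(hℓ' _ _).2] at this
  exact this

/-! ### The metric of the cells -/

lemma uniqueDiffOn_closedUnitBall {n : ℕ} : UniqueDiffOn ℝ (closedBall (0 : Eu n) 1) := by
  refine uniqueDiffOn_convex (convex_closedBall _ _) ?_
  rw [interior_closedBall _ one_ne_zero]
  exact ⟨0, by simp⟩

lemma contDiffOn_det {n m : ℕ} {K : Set (Eu n)} {M : Eu n → Matrix (Fin m) (Fin m) ℝ}
    (hM : ∀ i j, ContDiffOn ℝ ∞ (fun y => M y i j) K) : ContDiffOn ℝ ∞ (fun y => (M y).det) K := by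
  simp only [Matrix.det_apply]
  refine ContDiffOn.sum fun σ _ => ?_
  exact (contDiffOn_prod fun i _ => hM (σ i) i).const_smul _

section Cell

variable {n : ℕ} {p : ℝ≥0∞} {Ω : Set (Eu n)} {Ψ : Eu n → Eu n → Eu n}

lemma IsCellGeometry.contDiffOn_cellDeriv (hΨ : IsCellGeometry p Ω Ψ) {x : Eu n} (hx : x ∈ Ω)
    (i : Fin n) : ContDiffOn ℝ ∞ (fun y => cellDeriv Ψ x y i) (closedBall 0 1) := by
  obtain ⟨Θ, hΘ, -⟩ := hΨ.diffeo
  exact ((hΘ x hx).1.fderivWithin uniqueDiffOn_closedUnitBall (by simp)).clm_apply contDiffOn_const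

lemma IsCellGeometry.contDiffOn_gMat (hΨ : IsCellGeometry p Ω Ψ) {x : Eu n} (hx : x ∈ Ω)
    (i j : Fin n) : ContDiffOn ℝ ∞ (fun y => gMat Ψ x y i j) (closedBall 0 1) :=
  (hΨ.contDiffOn_cellDeriv hx i).inner ℝ (hΨ.contDiffOn_cellDeriv hx j)

/-- The derivative of `Ψ x` is injective up to the boundary of the ball, by the chain rule for
`Θ x ∘ Ψ x = id`. -/
lemma IsCellGeometry.injective_fderivWithin (hΨ : IsCellGeometry p Ω Ψ) {x y : Eu n} (hx : x ∈ Ω)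
    (hy : y ∈ closedBall 0 1) :
    Function.Injective (fderivWithin ℝ (Ψ x) (closedBall 0 1) y) := by
  obtain ⟨Θ, hΘ, -⟩ := hΨ.diffeo
  obtain ⟨h1, h2, h3, -, h5⟩ := hΘ x hx
  have hmaps : MapsTo (Ψ x) (closedBall 0 1) (closure (cell Ψ x)) := fun z hz =>
    h3 ▸ mem_image_of_mem _ hz
  have d1 := (h1.differentiableOn (by simp) y hy).hasFDerivWithinAt
  have d2 := (h2.differentiableOn (by simp) _ (hmaps hy)).hasFDerivWithinAt
  have d3 : HasFDerivWithinAt id _ (closedBall 0 1) y :=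
    (d2.comp y d1 hmaps).congr (fun z hz => (h5 hz).symm) (h5 hy).symm
  have e := (uniqueDiffOn_closedUnitBall y hy).eq d3 (hasFDerivWithinAt_id y _)
  intro v w hvw
  have := congrArg (fun A => A (v - w)) e
  simp only [ContinuousLinearMap.comp_apply, map_sub, hvw, sub_self,
    ContinuousLinearMap.id_apply] at this
  exact sub_eq_zero.1 this.symm

lemma IsCellGeometry.det_gMat_pos (hΨ : IsCellGeometry p Ω Ψ) {x y : Eu n} (hx : x ∈ Ω)
    (hy : y ∈ closedBall 0 1) : 0 < (gMat Ψ x y).det := by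
  have hli : LinearIndependent ℝ (fun i : Fin n => cellDeriv Ψ x y i) := by
    have hb : LinearIndependent ℝ (fun i : Fin n => basisVec i) := by
      have := (EuclideanSpace.basisFun (Fin n) ℝ).toBasis.linearIndependent
      have e : ⇑(EuclideanSpace.basisFun (Fin n) ℝ).toBasis = fun i => basisVec i := by
        ext1 i
        rw [OrthonormalBasis.coe_toBasis, EuclideanSpace.basisFun_apply, basisVec]
      rwa [e] at this
    exact hb.map' (fderivWithin ℝ (Ψ x) (closedBall 0 1) y).toLinearMap
      (LinearMap.ker_eq_bot.2 (hΨ.injective_fderivWithin hx hy))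
  exact (Matrix.posDef_gram_of_linearIndependent hli).det_pos

lemma IsCellGeometry.sqrtG_pos (hΨ : IsCellGeometry p Ω Ψ) {x y : Eu n} (hx : x ∈ Ω)
    (hy : y ∈ closedBall 0 1) : 0 < sqrtG Ψ x y :=
  Real.sqrt_pos.2 (hΨ.det_gMat_pos hx hy)

lemma gInv_symm (x y : Eu n) (i j : Fin n) : gInv Ψ x y i j = gInv Ψ x y j i := by
  have h : (gMat Ψ x y).transpose = gMat Ψ x y := by
    ext i j
    exact real_inner_comm (cellDeriv Ψ x y i) (cellDeriv Ψ x y j)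
  unfold gInv
  conv_lhs => rw [← h, ← Matrix.transpose_nonsing_inv]
  rfl

/-- The coefficients `√|g| g^{ij}` are smooth on the closed ball. -/
lemma IsCellGeometry.contDiffOn_coeff (hΨ : IsCellGeometry p Ω Ψ) {x : Eu n} (hx : x ∈ Ω)
    (i j : Fin n) :
    ContDiffOn ℝ ∞ (fun y => sqrtG Ψ x y * gInv Ψ x y i j) (closedBall 0 1) := by
  -- Cramer's rule; the determinant is positive, so that its square root and its inverse are smooth
  have hdet := contDiffOn_det (hΨ.contDiffOn_gMat hx)
  have hne : ∀ y ∈ closedBall (0 : Eu n) 1, (gMat Ψ x y).det ≠ 0 := fun y hy =>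
    (hΨ.det_gMat_pos hx hy).ne'
  refine (hdet.sqrt hne).mul ?_
  have hadj : ContDiffOn ℝ ∞ (fun y => (gMat Ψ x y).adjugate i j) (closedBall 0 1) := by
    simp only [Matrix.adjugate_apply]
    refine contDiffOn_det fun k l => ?_
    by_cases hk : k = j
    · subst hk
      simpa only [Matrix.updateRow_self] using contDiffOn_const
    · simpa only [Matrix.updateRow_ne hk] using hΨ.contDiffOn_gMat hx k l
  refine ((hdet.inv hne).mul hadj).congr fun y hy => ?_
  simp [gInv, Matrix.inv_def, Ring.inverse_eq_inv']

lemma IsCellGeometry.exists_lipschitzOnWith (hΨ : IsCellGeometry p Ω Ψ) :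
    ∃ K : ℝ≥0, ∀ x ∈ Ω, LipschitzOnWith K (Ψ x) (unitBall n) := by
  obtain ⟨K, hK⟩ := hΨ.lipschitz
  refine ⟨K, fun x hx => LipschitzOnWith.of_dist_le_mul fun y hy z hz => ?_⟩
  have := hK.dist_le_mul (x, y) ⟨hx, hy⟩ (x, z) ⟨hx, hz⟩
  simpa [cellMap, Prod.dist_eq] using this

/-- The volume density is bounded, uniformly in the cell, since `Ψ` is Lipschitz continuous. -/
lemma IsCellGeometry.exists_sqrtG_le (hΨ : IsCellGeometry p Ω Ψ) :
    ∃ C : ℝ, 0 ≤ C ∧ ∀ x ∈ Ω, ∀ y ∈ unitBall n, sqrtG Ψ x y ≤ C := by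
  obtain ⟨K, hK⟩ := hΨ.exists_lipschitzOnWith
  refine ⟨Real.sqrt (n.factorial • ((K : ℝ) * K) ^ n), Real.sqrt_nonneg _, fun x hx y hy => ?_⟩
  refine Real.sqrt_le_sqrt ?_
  have hd : ∀ i, ‖cellDeriv Ψ x y i‖ ≤ K := fun i => by
    have hnhds : unitBall n ∈ 𝓝 y := isOpen_ball.mem_nhds hy
    rw [cellDeriv, fderivWithin_of_mem_nhds (mem_of_superset hnhds ball_subset_closedBall)]
    refine (ContinuousLinearMap.le_of_opNorm_le _
      (norm_fderiv_le_of_lipschitzOn ℝ hnhds (hK x hx)) _).trans ?_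
    simp [basisVec]
  have := Matrix.det_le (A := gMat Ψ x y) (abv := AbsoluteValue.abs) (x := (K : ℝ) * K)
    (fun i j => (abs_real_inner_le_norm _ _).trans
      (mul_le_mul (hd i) (hd j) (norm_nonneg _) K.2))
  rw [Fintype.card_fin] at this
  exact (le_abs_self _).trans this

/-- On `Ω × B` the volume density agrees with a bounded function that is jointly measurable. It is
computed from the derivative of a Lipschitz extension of `Ψ`. -/
lemma IsCellGeometry.exists_measurable_sqrtG (hΨ : IsCellGeometry p Ω Ψ) (hΩ : MeasurableSet Ω) :
    ∃ w : Eu n → Eu n → ℝ, Measurable (Function.uncurry w) ∧ (∃ C, ∀ x y, |w x y| ≤ C) ∧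
      ∀ x ∈ Ω, ∀ y ∈ unitBall n, sqrtG Ψ x y = w x y := by
  obtain ⟨K, hK⟩ := hΨ.lipschitz
  obtain ⟨C, hC0, hC⟩ := hΨ.exists_sqrtG_le
  have hK2 : LipschitzOnWith (1 * K) (fun z : Eu n × Eu n => Ψ z.1 z.2) (Ω ×ˢ unitBall n) :=
    LipschitzWith.prod_snd.comp_lipschitzOnWith hK
  obtain ⟨G, hG, hGe⟩ := hK2.extend_finite_dimension
  set f : Eu n → Eu n → Eu n := fun x y => G (x, y) with hf
  have hder : Measurable fun z : Eu n × Eu n => fderiv ℝ (f z.1) z.2 :=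
    measurable_fderiv_with_param ℝ (f := f) hG.continuous
  set S : Eu n × Eu n → ℝ := fun z => Real.sqrt (Matrix.det (Matrix.of fun i j : Fin n =>
    (inner ℝ (fderiv ℝ (f z.1) z.2 (basisVec i)) (fderiv ℝ (f z.1) z.2 (basisVec j)) : ℝ))) with hS
  have hSm : Measurable S := by
    refine Real.continuous_sqrt.measurable.comp ?_
    simp only [Matrix.det_apply]
    refine Finset.measurable_sum _ fun σ _ => ?_
    refine Measurable.const_smul ?_ _
    refine Finset.measurable_prod _ fun i _ => ?_
    simp only [Matrix.of_apply]
    exact (hder.apply_continuousLinearMap _).inner (hder.apply_continuousLinearMap _)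
  have hSe : ∀ x ∈ Ω, ∀ y ∈ unitBall n, sqrtG Ψ x y = S (x, y) := fun x hx y hy => by
    have hnhds : unitBall n ∈ 𝓝 y := isOpen_ball.mem_nhds hy
    have : Ψ x =ᶠ[𝓝 y] f x := by
      filter_upwards [hnhds] with z hz
      exact (hGe (show (x, z) ∈ Ω ×ˢ unitBall n from ⟨hx, hz⟩))
    have e : ∀ i, cellDeriv Ψ x y i = fderiv ℝ (f x) y (basisVec i) := fun i => by
      rw [cellDeriv, fderivWithin_of_mem_nhds (mem_of_superset hnhds ball_subset_closedBall),
        this.fderiv_eq]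
    simp only [hS, sqrtG, gMat, e]
  have hB : MeasurableSet (unitBall n) := measurableSet_ball
  refine ⟨fun x y => (Ω ×ˢ unitBall n).indicator S (x, y), hSm.indicator (hΩ.prod hB),
    ⟨C, fun x y => ?_⟩, fun x hx y hy => ?_⟩
  · beta_reduce
    by_cases h : (x, y) ∈ Ω ×ˢ unitBall n
    · rw [indicator_of_mem h, ← hSe x h.1 y h.2,
        abs_of_nonneg (show 0 ≤ sqrtG Ψ x y from Real.sqrt_nonneg _)]
      exact hC x h.1 y h.2
    · rw [indicator_of_notMem h, abs_zero]
      exact hC0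
  · beta_reduce
    rw [indicator_of_mem (show (x, y) ∈ Ω ×ˢ unitBall n from ⟨hx, hy⟩), hSe x hx y hy]

end Cell

/-! ### The exchange term -/

/-- The mass that leaves the cell at `x` through its boundary is the exchange term. -/
lemma integral_sqrtG_laplaceBeltrami {n : ℕ} (hn : 1 ≤ n) {p : ℝ≥0∞} [hp : Fact (1 ≤ p)]
    {Ω : Set (Eu n)} {Ψ : Eu n → Eu n → Eu n} (hΨ : IsCellGeometry p Ω Ψ) {x : Eu n} (hx : x ∈ Ω)
    {v : W2 p (unitBall n)} {F : Eu n → ℝ} {r : ℝ} (hF : IsLaplaceBeltrami Ψ x v F)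
    (hr : IsExchange Ψ x v r) : ∫ y in unitBall n, sqrtG Ψ x y * F y = r := by
  obtain ⟨h, hh, hFe⟩ := hF
  obtain ⟨τ, hτ, rfl⟩ := hr
  have hB : MeasurableSet (unitBall n) := measurableSet_ball
  have key := fun i j => integral_weakPartial_mul_eq_flux hn hp.out (Lp.memLp (W2.d v j))
    (df := fun k => W2.dd v j k) (Lp.memLp (W2.dd v j i)) (v.2.2 j i) (hτ j)
    (hΨ.contDiffOn_coeff hx i j) (hh i j)
  have hflux := fun i j => integrable_flux hp.out i
    (hΨ.contDiffOn_coeff hx i j).continuousOn (hτ j).1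
  have e1 : ∫ y in unitBall n, sqrtG Ψ x y * F y = ∫ y in unitBall n, -∑ i, ∑ j, h i j y := by
    refine integral_congr_ae ?_
    filter_upwards [hFe, ae_restrict_mem hB] with y hy hyB
    have := (hΨ.sqrtG_pos hx (ball_subset_closedBall hyB)).ne'
    rw [hy]
    field_simp
  rw [e1, integral_neg, neg_inj, integral_finsetSum _ fun i _ =>
    integrable_finsetSum _ fun j _ => (key i j).1]
  simp only [integral_finsetSum Finset.univ fun j _ => (key _ j).1, (key _ _).2]
  -- the indices of `IsExchange` are those of `IsLaplaceBeltrami` with `i` and `j` exchanged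
  have e2 : ∀ s : Eu n, ∑ i, ∑ j, sqrtG Ψ x s * gInv Ψ x s i j * τ i s * s j
      = ∑ i, ∑ j, sqrtG Ψ x s * gInv Ψ x s i j * τ j s * s i := fun s => by
    rw [Finset.sum_comm]
    refine Finset.sum_congr rfl fun i _ => Finset.sum_congr rfl fun j _ => ?_
    rw [gInv_symm x s j i]
  simp only [e2]
  rw [integral_finsetSum _ fun i _ => integrable_finsetSum _ fun j _ => hflux i j]
  simp only [integral_finsetSum Finset.univ fun j _ => hflux _ j]

/-! ### Thin layers around a hypersurface -/

/-- The projection of `ℝᵐ⁺¹` to `ℝᵐ` (with the maximum norm) that forgets the coordinate `i`. -/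
def drop {m : ℕ} (i : Fin (m + 1)) : Eu (m + 1) →L[ℝ] (Fin m → ℝ) :=
  ContinuousLinearMap.pi fun j => EuclideanSpace.proj (i.succAbove j)

/-- The point of `ℝᵐ⁺¹` with `i`-th coordinate `s` and with the other coordinates given by `x`. -/
def ins {m : ℕ} (i : Fin (m + 1)) (s : ℝ) (x : Fin m → ℝ) : Eu (m + 1) :=
  WithLp.toLp 2 (i.insertNth s x)

section Coordinates

variable {m : ℕ} (i : Fin (m + 1))

@[simp] lemma drop_apply (x : Eu (m + 1)) (j : Fin m) : drop i x j = x (i.succAbove j) := rfl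

@[simp] lemma ins_apply_self (s : ℝ) (x : Fin m → ℝ) : ins i s x i = s := by simp [ins]

@[simp] lemma drop_ins (s : ℝ) (x : Fin m → ℝ) : drop i (ins i s x) = x := by
  ext j; simp [ins]

lemma ins_drop (x : Eu (m + 1)) : ins i (x i) (drop i x) = x := by
  ext j
  refine Fin.succAboveCases i ?_ (fun k => ?_) j <;> simp [ins]

lemma measurable_ins : Measurable fun z : ℝ × (Fin m → ℝ) => ins i z.1 z.2 := by
  have h := (MeasurableEquiv.piFinSuccAbove (fun _ : Fin (m + 1) => ℝ) i).symm.measurable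
  exact (PiLp.volume_preserving_toLp (Fin (m + 1))).measurable.comp h

lemma continuous_ins (x : Fin m → ℝ) : Continuous fun s => ins i s x := by
  refine (PiLp.continuous_toLp 2 _).comp (continuous_pi fun j => ?_)
  refine Fin.succAboveCases i ?_ (fun k => ?_) j
  · simpa only [Fin.insertNth_apply_same] using continuous_id'
  · simpa using continuous_const

lemma lintegral_eq_lintegral_ins {f : Eu (m + 1) → ℝ≥0∞} (hf : Measurable f) :
    ∫⁻ x, f x = ∫⁻ x : Fin m → ℝ, ∫⁻ s : ℝ, f (ins i s x) := by
  have h1 := (PiLp.volume_preserving_toLp (Fin (m + 1))).comp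
    (volume_preserving_piFinSuccAbove (fun _ : Fin (m + 1) => ℝ) i).symm
  have h2 := h1.lintegral_comp hf
  rw [← h2, Measure.volume_eq_prod, lintegral_prod_symm _ (by
    exact (hf.comp (measurable_ins i)).aemeasurable)]
  rfl

lemma lipschitzWith_drop : LipschitzWith 1 (drop i : Eu (m + 1) → Fin m → ℝ) := by
  refine LipschitzWith.of_dist_le_mul fun x y => ?_
  rw [NNReal.coe_one, one_mul, dist_pi_le_iff dist_nonneg]
  intro j
  rw [drop_apply, drop_apply, Real.dist_eq, dist_eq_norm]
  exact PiLp.norm_apply_le (x - y) (i.succAbove j)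

lemma abs_sub_le_dist_ins (s : ℝ) (x : Fin m → ℝ) (y : Eu (m + 1)) :
    |s - y i| ≤ dist (ins i s x) y := by
  have := PiLp.norm_apply_le (ins i s x - y) i
  rw [dist_eq_norm]
  simpa using this

/-- Near a point where the `i`-th partial derivative of `ρ` does not vanish, the value of `ρ` and
the coordinates other than the `i`-th are bi-Lipschitz coordinates. -/
lemma exists_dist_le_of_partial_ne_zero {ρ : Eu (m + 1) → ℝ} (hρ : ContDiff ℝ ∞ ρ) {x : Eu (m + 1)}
    (hx : fderiv ℝ ρ x (basisVec i) ≠ 0) :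
    ∃ K : ℝ≥0, ∃ N ∈ 𝓝 x, ∀ a ∈ N, ∀ b ∈ N,
      dist a b ≤ K * max |ρ a - ρ b| (dist (drop i a) (drop i b)) := by
  have hst : HasStrictFDerivAt (fun y => (ρ y, drop i y)) ((fderiv ℝ ρ x).prod (drop i)) x :=
    (hρ.contDiffAt.hasStrictFDerivAt (by simp)).prodMk (drop i).hasStrictFDerivAt
  set A := (fderiv ℝ ρ x).prod (drop i) with hA
  have hker : A.toLinearMap.ker = ⊥ := by
    refine LinearMap.ker_eq_bot'.2 fun v hv => ?_
    have hv1 : fderiv ℝ ρ x v = 0 := congrArg Prod.fst hv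
    have hv2 : drop i v = 0 := congrArg Prod.snd hv
    have e : v = v i • basisVec i := by
      ext j
      refine Fin.succAboveCases i ?_ (fun k => ?_) j
      · simp [basisVec]
      · have := congrFun hv2 k
        simpa [basisVec, Fin.succAbove_ne] using this
    rw [e, map_smul, smul_eq_mul] at hv1
    rw [e, (mul_eq_zero.1 hv1).resolve_right hx, zero_smul]
  obtain ⟨K, hK, hanti⟩ := A.toLinearMap.exists_antilipschitzWith hker
  have hK' : (0 : ℝ) < K := hK
  -- strict differentiability, with half of the constant that the linear map `A` allows
  have hlo := hst.isLittleO.def (c := 1 / (2 * K)) (by positivity)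
  rw [nhds_prod_eq] at hlo
  obtain ⟨N, hN, hNp⟩ := (eventually_prod_self_iff (r := fun a b : Eu (m + 1) =>
    ‖(ρ a, drop i a) - (ρ b, drop i b) - A (a - b)‖ ≤ 1 / (2 * K) * ‖a - b‖)).1 hlo
  refine ⟨2 * K, N, hN, fun a ha b hb => ?_⟩
  have h1 := hNp a ha b hb
  have h2 : dist a b ≤ K * ‖A (a - b)‖ := by
    have := hanti.le_mul_dist a b
    rw [dist_eq_norm (A.toLinearMap a)] at this
    simpa using this
  have h3 : ‖A (a - b)‖ ≤ ‖((ρ a, drop i a) : ℝ × (Fin m → ℝ)) - (ρ b, drop i b)‖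
      + 1 / (2 * K) * ‖a - b‖ := by
    have := norm_sub_norm_le (A (a - b)) (((ρ a, drop i a) : ℝ × (Fin m → ℝ)) - (ρ b, drop i b))
    rw [norm_sub_rev (A (a - b))] at this
    linarith
  have h4 : ‖((ρ a, drop i a) : ℝ × (Fin m → ℝ)) - (ρ b, drop i b)‖
      = max |ρ a - ρ b| (dist (drop i a) (drop i b)) := by
    rw [← dist_eq_norm, Prod.dist_eq, Real.dist_eq]
  rw [h4, ← dist_eq_norm] at h3
  have h5 : (K : ℝ) * (1 / (2 * K) * dist a b) = dist a b / 2 := by field_simp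
  have h6 := h2.trans (mul_le_mul_of_nonneg_left h3 hK'.le)
  rw [mul_add, h5] at h6
  push_cast
  linarith

variable {i} {ρ : Eu (m + 1) → ℝ} {S : Set (Eu (m + 1))} {K : ℝ≥0}

lemma dist_le_of_mem_zeroSet
    (hK : ∀ a ∈ S, ∀ b ∈ S, dist a b ≤ K * max |ρ a - ρ b| (dist (drop i a) (drop i b)))
    {a b : Eu (m + 1)} (ha : a ∈ S ∩ {x | ρ x = 0}) (hb : b ∈ S ∩ {x | ρ x = 0}) :
    dist a b ≤ K * dist (drop i a) (drop i b) := by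
  have ha' : ρ a = 0 := ha.2
  have hb' : ρ b = 0 := hb.2
  have := hK a ha.1 b hb.1
  rwa [ha', hb', sub_zero, abs_zero, max_eq_right dist_nonneg] at this

/-- The image of Hausdorff measure under the projection dominates the Lebesgue measure, since the
projection is `1`-Lipschitz and, for the maximum norm, Lebesgue measure is Hausdorff measure. -/
lemma restrict_image_drop_le (A : Set (Eu (m + 1))) :
    (volume : Measure (Fin m → ℝ)).restrict (drop i '' A)
      ≤ ((Measure.hausdorffMeasure (m : ℝ)).restrict A).map (drop i) := by
  refine Measure.le_iff.2 fun E hE => ?_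
  rw [Measure.restrict_apply hE, Measure.map_apply (drop i).continuous.measurable hE,
    Measure.restrict_apply ((drop i).continuous.measurable hE)]
  have e : E ∩ drop i '' A = drop i '' (drop i ⁻¹' E ∩ A) := by
    rw [inter_comm, inter_comm _ A, image_inter_preimage]
  have hv : (volume : Measure (Fin m → ℝ)) = Measure.hausdorffMeasure (m : ℝ) := by
    rw [← hausdorffMeasure_pi_real, Fintype.card_fin]
  rw [e, hv]
  have := (lipschitzWith_drop i).lipschitzOnWith (s := drop i ⁻¹' E ∩ A)
    |>.hausdorffMeasure_image_le (d := (m : ℝ)) (Nat.cast_nonneg _)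
  simpa using this

/-- The zero set of `ρ` in `S` is a Lipschitz graph over a compact set. -/
lemma hausdorffMeasure_zeroSet_lt_top (hρ : Continuous ρ) (hS : IsCompact S)
    (hK : ∀ a ∈ S, ∀ b ∈ S, dist a b ≤ K * max |ρ a - ρ b| (dist (drop i a) (drop i b))) :
    Measure.hausdorffMeasure (m : ℝ) (S ∩ {x | ρ x = 0}) < ⊤ := by
  set A := S ∩ {x | ρ x = 0} with hA
  have hAc : IsCompact A := hS.inter_right (isClosed_eq hρ continuous_const)
  have hinj : InjOn (drop i) A := fun a ha b hb hab => by
    have := dist_le_of_mem_zeroSet hK ha hb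
    rw [hab, dist_self, mul_zero] at this
    exact dist_le_zero.1 this
  set inv := Function.invFunOn (drop i) A with hinv
  have hleft : LeftInvOn inv (drop i) A := hinj.leftInvOn_invFunOn
  have hlip : LipschitzOnWith K inv (drop i '' A) := by
    refine LipschitzOnWith.of_dist_le_mul ?_
    rintro _ ⟨a, ha, rfl⟩ _ ⟨b, hb, rfl⟩
    rw [hleft ha, hleft hb]
    exact dist_le_of_mem_zeroSet hK ha hb
  have := hlip.hausdorffMeasure_image_le (d := (m : ℝ)) (Nat.cast_nonneg _)
  rw [hleft.image_image] at this
  refine this.trans_lt (ENNReal.mul_lt_top (ENNReal.rpow_lt_top_of_nonneg (Nat.cast_nonneg _)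
    ENNReal.coe_ne_top) ?_)
  have hv : (volume : Measure (Fin m → ℝ)) = Measure.hausdorffMeasure (m : ℝ) := by
    rw [← hausdorffMeasure_pi_real, Fintype.card_fin]
  rw [← hv]
  exact (hAc.image (drop i).continuous).measure_lt_top

/-- On a line in direction `i`, the layer `|ρ| ≤ 1 / k` in `S` has length at most `2 K / k`. So the
mean of `g` over its part of the layer is at most `2 K` times an upper bound of `g` there. -/
lemma mul_lintegral_line_le
    (hK : ∀ a ∈ S, ∀ b ∈ S, dist a b ≤ K * max |ρ a - ρ b| (dist (drop i a) (drop i b)))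
    {g : Eu (m + 1) → ℝ≥0∞} (hgS : ∀ x ∉ S, g x = 0) (k : ℕ) (x : Fin m → ℝ) (c : ℝ≥0∞)
    (hc : ∀ s, ins i s x ∈ S → |ρ (ins i s x)| ≤ 1 / k → g (ins i s x) ≤ c) :
    (k : ℝ≥0∞) * ∫⁻ s, {y | |ρ y| ≤ 1 / k}.indicator g (ins i s x) ≤ 2 * K * c := by
  rcases Nat.eq_zero_or_pos k with rfl | hk
  · simp
  have hk' : (0 : ℝ) < k := by exact_mod_cast hk
  set T : Set ℝ := {s | ins i s x ∈ S ∧ |ρ (ins i s x)| ≤ 1 / k} with hT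
  have h1 : ∫⁻ s, {y | |ρ y| ≤ 1 / k}.indicator g (ins i s x) ≤ ∫⁻ s, T.indicator (fun _ => c) s := by
    refine lintegral_mono fun s => ?_
    by_cases h1 : |ρ (ins i s x)| ≤ 1 / k
    · by_cases h2 : ins i s x ∈ S
      · rw [indicator_of_mem (show ins i s x ∈ {y | |ρ y| ≤ 1 / k} from h1),
          indicator_of_mem (show s ∈ T from ⟨h2, h1⟩)]
        exact hc s h2 h1
      · refine (indicator_le_self' (fun _ _ => zero_le) _).trans ?_
        rw [hgS _ h2]
        exact zero_le
    · rw [indicator_of_notMem (show ins i s x ∉ {y | |ρ y| ≤ 1 / k} from h1)]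
      exact zero_le
  have h2 : volume T ≤ ENNReal.ofReal (K * (2 / k)) := by
    refine (Real.volume_le_diam T).trans (ediam_le_of_forall_dist_le ?_)
    rintro s ⟨hs, hs'⟩ t ⟨ht, ht'⟩
    have h3 := hK _ hs _ ht
    rw [drop_ins, drop_ins, dist_self, max_eq_left (abs_nonneg _)] at h3
    have h4 := abs_sub_le_dist_ins i s x (ins i t x)
    rw [ins_apply_self] at h4
    rw [Real.dist_eq]
    refine (h4.trans h3).trans (mul_le_mul_of_nonneg_left ?_ K.2)
    calc |ρ (ins i s x) - ρ (ins i t x)| ≤ |ρ (ins i s x)| + |ρ (ins i t x)| := abs_sub _ _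
      _ ≤ 1 / k + 1 / k := add_le_add hs' ht'
      _ = 2 / k := by ring
  calc (k : ℝ≥0∞) * ∫⁻ s, {y | |ρ y| ≤ 1 / k}.indicator g (ins i s x)
      ≤ k * (c * ENNReal.ofReal (K * (2 / k))) := by
        gcongr
        exact h1.trans ((lintegral_indicator_const_le _ _).trans (by gcongr))
    _ = (k * ENNReal.ofReal (K * (2 / k))) * c := by ring
    _ = 2 * K * c := by
        congr 1
        rw [← ENNReal.ofReal_natCast, ← ENNReal.ofReal_mul hk'.le,
          show (k : ℝ) * (K * (2 / k)) = 2 * K by field_simp, ENNReal.ofReal_mul zero_le_two]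
        simp

/-- The mean of a continuous function over the thin layers `|ρ| ≤ 1 / k` is asymptotically bounded
by its integral over the hypersurface `ρ = 0` with respect to Hausdorff measure. -/
lemma limsup_layer_le (hρ : Continuous ρ) (hS : IsCompact S)
    (hK : ∀ a ∈ S, ∀ b ∈ S, dist a b ≤ K * max |ρ a - ρ b| (dist (drop i a) (drop i b)))
    {g : Eu (m + 1) → ℝ} (hg : Continuous g) (hgS : ∀ x ∉ S, g x = 0) :
    limsup (fun k : ℕ => (k : ℝ≥0∞) * ∫⁻ x in {x | |ρ x| ≤ 1 / k}, ENNReal.ofReal (g x)) atTop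
      ≤ 2 * K * ∫⁻ x in S ∩ {x | ρ x = 0}, ENNReal.ofReal (g x)
        ∂Measure.hausdorffMeasure (m : ℝ) := by
  set A := S ∩ {x | ρ x = 0} with hA
  have hgm : Measurable fun x => ENNReal.ofReal (g x) := hg.measurable.ennreal_ofReal
  have hgS' : ∀ x ∉ S, ENNReal.ofReal (g x) = 0 := fun x hx => by simp [hgS x hx]
  have hlay : ∀ k : ℕ, MeasurableSet {x | |ρ x| ≤ 1 / (k : ℝ)} := fun k =>
    (isClosed_le hρ.abs continuous_const).measurableSet
  have hJ : ∀ k : ℕ, Measurable fun x : Fin m → ℝ => (k : ℝ≥0∞) *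
      ∫⁻ s, {y | |ρ y| ≤ 1 / (k : ℝ)}.indicator (fun x => ENNReal.ofReal (g x)) (ins i s x) :=
    fun k => by
      refine Measurable.const_mul ?_ _
      exact Measurable.lintegral_prod_left' (f := fun z : ℝ × (Fin m → ℝ) =>
        {y | |ρ y| ≤ 1 / (k : ℝ)}.indicator (fun x => ENNReal.ofReal (g x)) (ins i z.1 z.2))
        ((hgm.indicator (hlay k)).comp (measurable_ins i))
  have e : ∀ k : ℕ, (k : ℝ≥0∞) * ∫⁻ x in {x | |ρ x| ≤ 1 / (k : ℝ)}, ENNReal.ofReal (g x)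
      = ∫⁻ x : Fin m → ℝ, (k : ℝ≥0∞) *
      ∫⁻ s, {y | |ρ y| ≤ 1 / (k : ℝ)}.indicator (fun x => ENNReal.ofReal (g x)) (ins i s x) :=
    fun k => by
      rw [← lintegral_indicator (hlay k), lintegral_eq_lintegral_ins i (hgm.indicator (hlay k)),
        lintegral_const_mul' _ _ (ENNReal.natCast_ne_top k)]
  simp only [e]
  -- the reverse Fatou lemma, with a majorant supported over the projection of `S`
  obtain ⟨M, hM⟩ := hS.exists_bound_of_continuousOn hg.continuousOn
  have hSc : IsCompact (drop i '' S) := hS.image (drop i).continuous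
  refine (limsup_lintegral_le ((drop i '' S).indicator fun _ => 2 * K * ENNReal.ofReal M) hJ
    (fun k => ae_of_all _ fun x => ?_) ?_).trans ?_
  · by_cases hx : x ∈ drop i '' S
    · rw [indicator_of_mem hx]
      refine mul_lintegral_line_le hK hgS' k x _ fun s hs _ => ?_
      exact ENNReal.ofReal_le_ofReal ((le_abs_self _).trans (hM _ hs))
    · rw [indicator_of_notMem hx]
      refine (mul_lintegral_line_le hK hgS' k x 0 fun s hs _ => ?_).trans (by simp)
      exact absurd ⟨_, hs, drop_ins i s x⟩ hx
  · rw [lintegral_indicator_const hSc.measurableSet]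
    exact ENNReal.mul_ne_top (ENNReal.mul_ne_top (ENNReal.mul_ne_top (by simp) (by simp))
      ENNReal.ofReal_ne_top) hSc.measure_lt_top.ne
  -- the line over a point of the projected zero set meets that set in one point `a` only, so that
  -- the supremum below is `g a`; no measurability of the inverse projection is needed
  set f : (Fin m → ℝ) → ℝ≥0∞ := fun x => ⨆ a ∈ {a | a ∈ A ∧ drop i a = x}, ENNReal.ofReal (g a)
    with hf
  have hlim : ∀ x, limsup (fun k : ℕ => (k : ℝ≥0∞) *
      ∫⁻ s, {y | |ρ y| ≤ 1 / (k : ℝ)}.indicator (fun x => ENNReal.ofReal (g x)) (ins i s x)) atTop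
      ≤ (drop i '' A).indicator (fun x => 2 * K * f x) x := fun x => by
    by_cases hx : x ∈ drop i '' A
    · rw [indicator_of_mem hx]
      obtain ⟨a, ha, rfl⟩ := hx
      have hfa : ENNReal.ofReal (g a) ≤ f (drop i a) := le_iSup₂_of_le a ⟨ha, rfl⟩ le_rfl
      refine le_trans ?_ (mul_le_mul_right hfa _)
      have ht : Tendsto (fun δ : ℝ => 2 * (K : ℝ≥0∞) * ENNReal.ofReal (g a + δ)) (𝓝[>] 0)
          (𝓝 (2 * K * ENNReal.ofReal (g a))) := by
        refine ENNReal.Tendsto.const_mul ?_ (Or.inr (ENNReal.mul_ne_top (by simp) (by simp)))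
        refine (ENNReal.continuous_ofReal.tendsto _).comp ?_
        have : Tendsto (fun δ : ℝ => g a + δ) (𝓝 0) (𝓝 (g a + 0)) := tendsto_const_nhds.add
          tendsto_id
        rw [add_zero] at this
        exact this.mono_left nhdsWithin_le_nhds
      refine ge_of_tendsto ht ?_
      filter_upwards [self_mem_nhdsWithin] with δ hδ
      refine limsup_le_of_le ?_ ?_
      · exact isCoboundedUnder_le_of_eventually_le _ (Eventually.of_forall fun _ => zero_le)
      have hcont := (hg.comp (continuous_ins i (drop i a))).tendsto (a i)
      simp only [Function.comp_apply, ins_drop] at hcont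
      obtain ⟨r, hr, hball⟩ := Metric.eventually_nhds_iff.1
        (hcont.eventually_lt_const (show g a < g a + δ from lt_add_of_pos_right _ hδ))
      have hk0 : Tendsto (fun k : ℕ => (K : ℝ) * (1 / (k : ℝ))) atTop (𝓝 0) := by
        simpa using tendsto_one_div_atTop_nhds_zero_nat.const_mul (K : ℝ)
      filter_upwards [hk0.eventually_lt_const hr] with k hk
      refine mul_lintegral_line_le hK hgS' k _ _ fun s hs hs' => ?_
      refine ENNReal.ofReal_le_ofReal (hball ?_).le
      have h1 := hK _ hs a ha.1
      have ha0 : ρ a = 0 := ha.2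
      rw [drop_ins, dist_self, max_eq_left (abs_nonneg _), ha0, sub_zero] at h1
      rw [Real.dist_eq]
      exact ((abs_sub_le_dist_ins i s _ a).trans h1).trans_lt
        ((mul_le_mul_of_nonneg_left hs' K.2).trans_lt hk)
    · rw [indicator_of_notMem hx]
      -- the line misses the zero set, hence also the layers for large `k`
      have hc : IsCompact (S ∩ drop i ⁻¹' {x}) :=
        hS.inter_right (isClosed_singleton.preimage (drop i).continuous)
      have hpos : ∃ δ > 0, ∀ y ∈ S ∩ drop i ⁻¹' {x}, δ ≤ |ρ y| := by
        rcases (S ∩ drop i ⁻¹' {x}).eq_empty_or_nonempty with h0 | hne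
        · exact ⟨1, one_pos, by simp [h0]⟩
        · obtain ⟨y, hy, hmin⟩ := hc.exists_isMinOn hne hρ.abs.continuousOn
          refine ⟨|ρ y|, abs_pos.2 fun h0 => hx ⟨y, ⟨hy.1, h0⟩, hy.2⟩, fun z hz => hmin hz⟩
      obtain ⟨δ, hδ, hb⟩ := hpos
      refine limsup_le_of_le ?_ ?_
      · exact isCoboundedUnder_le_of_eventually_le _ (Eventually.of_forall fun _ => zero_le)
      filter_upwards [(tendsto_one_div_atTop_nhds_zero_nat (𝕜 := ℝ)).eventually_lt_const hδ]
        with k hk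
      refine (mul_lintegral_line_le hK hgS' k x 0 fun s hs hs' => ?_).trans (by simp)
      exact absurd (hb _ ⟨hs, drop_ins i s x⟩) (not_le.2 (hs'.trans_lt hk))
  have hAc : IsCompact A := hS.inter_right (isClosed_eq hρ continuous_const)
  have hAm : MeasurableSet (drop i '' A) := (hAc.image (drop i).continuous).measurableSet
  calc _ ≤ ∫⁻ x, (drop i '' A).indicator (fun x => 2 * K * f x) x := lintegral_mono hlim
    _ = 2 * K * ∫⁻ x in drop i '' A, f x := by
        rw [lintegral_indicator hAm,
          lintegral_const_mul' _ _ (ENNReal.mul_ne_top (by simp) (by simp))]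
    _ ≤ 2 * K * ∫⁻ x, f x ∂((Measure.hausdorffMeasure (m : ℝ)).restrict A).map (drop i) := by
        gcongr
        exact restrict_image_drop_le A
    _ ≤ 2 * K * ∫⁻ x in A, f (drop i x) ∂Measure.hausdorffMeasure (m : ℝ) := by
        gcongr
        exact lintegral_map_le _ _
    _ ≤ _ := by
        gcongr 2 * K * ?_
        refine setLIntegral_mono hgm fun a ha => ?_
        refine iSup₂_le fun b hb => ?_
        have := dist_le_of_mem_zeroSet hK hb.1 ha
        rw [hb.2, dist_self, mul_zero] at this
        rw [dist_le_zero.1 this]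

end Coordinates

/-! ### Local defining functions and normals -/

lemma fderiv_apply_eq_sum {n : ℕ} (ρ : Eu n → ℝ) (x v : Eu n) :
    fderiv ℝ ρ x v = ∑ i, v i * fderiv ℝ ρ x (basisVec i) := by
  have e : v = ∑ i, v i • basisVec i := by
    ext j
    simp [basisVec, Finset.sum_apply, Pi.single_apply]
  conv_lhs => rw [e]
  simp [map_sum]

lemma tendsto_slope_line {n : ℕ} {ρ : Eu n → ℝ} (hρ : ContDiff ℝ ∞ ρ) {x : Eu n} (h0 : ρ x = 0)
    (v : Eu n) : Tendsto (fun t : ℝ => t⁻¹ * ρ (x + t • v)) (𝓝[>] 0) (𝓝 (fderiv ℝ ρ x v)) := by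
  have h1 : HasDerivAt (fun t : ℝ => ρ (x + t • v)) (fderiv ℝ ρ x v) 0 := by
    have := (hρ.differentiable (by simp) x).hasFDerivAt.hasLineDerivAt v
    simpa [HasLineDerivAt] using this
  have := h1.tendsto_slope_zero_right
  simpa [h0] using this

lemma tendsto_line {n : ℕ} (x v : Eu n) :
    Tendsto (fun t : ℝ => x + t • v) (𝓝[>] 0) (𝓝 x) := by
  have : Tendsto (fun t : ℝ => x + t • v) (𝓝 0) (𝓝 (x + (0 : ℝ) • v)) :=
    tendsto_const_nhds.add (tendsto_id.smul_const v)
  rw [zero_smul, add_zero] at this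
  exact this.mono_left nhdsWithin_le_nhds

namespace IsLocalDefiningFunction

variable {n : ℕ} {Ω : Set (Eu n)} {x : Eu n} {ρ ρ' : Eu n → ℝ}

/-- A direction along which the defining function decreases points into the domain. -/
lemma eventually_mem (h : IsLocalDefiningFunction Ω x ρ) {v : Eu n} (hv : fderiv ℝ ρ x v < 0) :
    ∀ᶠ t : ℝ in 𝓝[>] 0, x + t • v ∈ Ω := by
  filter_upwards [(tendsto_slope_line h.1 h.2.1 v).eventually_lt_const hv,
    (tendsto_line x v).eventually h.2.2.2, self_mem_nhdsWithin] with t h1 h2 h3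
  refine h2.2 ?_
  by_contra hc
  exact absurd h1 (not_lt.2 (mul_nonneg (inv_nonneg.2 (le_of_lt h3)) (not_lt.1 hc)))

lemma fderiv_nonpos (h : IsLocalDefiningFunction Ω x ρ) (h' : IsLocalDefiningFunction Ω x ρ')
    {v : Eu n} (hv : fderiv ℝ ρ x v < 0) : fderiv ℝ ρ' x v ≤ 0 := by
  refine le_of_tendsto (tendsto_slope_line h'.1 h'.2.1 v) ?_
  filter_upwards [h.eventually_mem hv, (tendsto_line x v).eventually h'.2.2.2,
    self_mem_nhdsWithin] with t h1 h2 h3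
  exact mul_nonpos_of_nonneg_of_nonpos (inv_nonneg.2 (le_of_lt h3)) (h2.1 h1).le

lemma fderiv_neg_gradient (h : IsLocalDefiningFunction Ω x ρ) :
    fderiv ℝ ρ x (-gradient ρ x) < 0 := by
  rw [map_neg, ← inner_gradient_left (𝕜 := ℝ), real_inner_self_eq_norm_sq, neg_lt_zero]
  have := norm_pos_iff.2 h.2.2.1
  positivity

/-- Two defining functions have the same tangent space at a boundary point. -/
lemma fderiv_eq_zero (h : IsLocalDefiningFunction Ω x ρ) (h' : IsLocalDefiningFunction Ω x ρ')
    {v : Eu n} (hv : fderiv ℝ ρ x v = 0) : fderiv ℝ ρ' x v = 0 := by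
  -- a tangent direction is a limit of directions that point into the domain
  have key : ∀ w, fderiv ℝ ρ x w = 0 → fderiv ℝ ρ' x w ≤ 0 := fun w hw => by
    have hlim : Tendsto (fun δ : ℝ => fderiv ℝ ρ' x (w + δ • -gradient ρ x)) (𝓝[>] 0)
        (𝓝 (fderiv ℝ ρ' x w)) :=
      ((fderiv ℝ ρ' x).continuous.tendsto w).comp (tendsto_line w _)
    refine le_of_tendsto hlim ?_
    filter_upwards [self_mem_nhdsWithin] with δ hδ
    refine h.fderiv_nonpos h' ?_
    rw [map_add, hw, zero_add, map_smul, smul_eq_mul]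
    exact mul_neg_of_pos_of_neg hδ h.fderiv_neg_gradient
  refine le_antisymm (key v hv) ?_
  have := key (-v) (by rw [map_neg, hv, neg_zero])
  rw [map_neg] at this
  linarith

lemma mem_frontier (h : IsLocalDefiningFunction Ω x ρ) : x ∈ frontier Ω := by
  refine ⟨mem_closure_of_tendsto (tendsto_line x _) (h.eventually_mem h.fderiv_neg_gradient),
    fun hx => ?_⟩
  have := h.2.2.2.self_of_nhds.1 (interior_subset hx)
  rw [h.2.1] at this
  exact lt_irrefl _ this

lemma eventually_nhds (h : IsLocalDefiningFunction Ω x ρ) :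
    ∀ᶠ y in 𝓝 x, (y ∈ Ω ↔ ρ y < 0) ∧ (ρ y = 0 → IsLocalDefiningFunction Ω y ρ) := by
  have hc : Continuous (gradient ρ) := by
    have : gradient ρ = fun y => (InnerProductSpace.toDual ℝ (Eu n)).symm (fderiv ℝ ρ y) := rfl
    rw [this]
    exact (InnerProductSpace.toDual ℝ (Eu n)).symm.continuous.comp
      (h.1.continuous_fderiv (by simp))
  filter_upwards [eventually_eventually_nhds.2 h.2.2.2, h.2.2.2,
    hc.continuousAt.eventually_ne h.2.2.1] with y h1 h2 h3
  exact ⟨h2, fun h0 => ⟨h.1, h0, h3, h1⟩⟩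

lemma exists_partial_ne_zero (h : IsLocalDefiningFunction Ω x ρ) :
    ∃ i, fderiv ℝ ρ x (basisVec i) ≠ 0 := by
  by_contra! hc
  have := h.fderiv_neg_gradient
  rw [fderiv_apply_eq_sum] at this
  simp [hc] at this

/-- A vector that is orthogonal to an outer normal is annihilated by the derivative of every
defining function. -/
lemma sum_mul_partial_eq_zero (h : IsLocalDefiningFunction Ω x ρ) {ν : Eu n}
    (hν : IsOuterUnitNormal Ω x ν) {τ : Fin n → ℝ} (hτ : ∑ i, τ i * ν i = 0) :
    ∑ i, τ i * fderiv ℝ ρ x (basisVec i) = 0 := by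
  obtain ⟨ρ', h', rfl⟩ := hν
  set v : Eu n := WithLp.toLp 2 τ with hv
  have hne : ‖gradient ρ' x‖⁻¹ ≠ 0 := inv_ne_zero (norm_ne_zero_iff.2 h'.2.2.1)
  have h1 : fderiv ℝ ρ' x v = 0 := by
    have : ‖gradient ρ' x‖⁻¹ * fderiv ℝ ρ' x v = 0 := by
      rw [← inner_gradient_left (𝕜 := ℝ), ← real_inner_smul_left, PiLp.inner_apply, ← hτ]
      exact Finset.sum_congr rfl fun i _ => by simp [hv]
    exact (mul_eq_zero.1 this).resolve_left hne
  have h2 := h'.fderiv_eq_zero h h1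
  rwa [fderiv_apply_eq_sum] at h2

end IsLocalDefiningFunction

/-! ### The divergence theorem near the boundary -/

lemma exists_abs_deriv_smoothTransition_le :
    ∃ M : ℝ, 0 ≤ M ∧ ∀ t, |deriv Real.smoothTransition t| ≤ M := by
  obtain ⟨M, hM⟩ := (isCompact_Icc (a := (0 : ℝ)) (b := 1)).exists_bound_of_continuousOn
    continuous_deriv_smoothTransition.continuousOn
  have hM0 : 0 ≤ M := (norm_nonneg _).trans (hM 0 (by simp))
  refine ⟨M, hM0, fun t => ?_⟩
  by_cases ht : t ∈ Icc (0 : ℝ) 1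
  · exact hM t ht
  · rw [deriv_smoothTransition_eq_zero, abs_zero]
    · exact hM0
    · by_contra hc
      push Not at hc
      exact ht hc

/-- A one-sided divergence theorem: where the domain is given by `ρ < 0`, the integral of a
divergence is controlled by the normal component of the field on the boundary. It is obtained by
inserting the cutoff functions `smoothTransition (-k ρ)`, whose derivatives live in the layers
`|ρ| ≤ 1 / k`. -/
lemma exists_integral_div_le {m : ℕ} {i : Fin (m + 1)} {Ω S : Set (Eu (m + 1))}
    (hΩ : MeasurableSet Ω) {ρ : Eu (m + 1) → ℝ} (hρ : ContDiff ℝ ∞ ρ) (hS : IsCompact S) {K : ℝ≥0}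
    (hK : ∀ a ∈ S, ∀ b ∈ S, dist a b ≤ K * max |ρ a - ρ b| (dist (drop i a) (drop i b)))
    (hΩS : ∀ y ∈ S, (y ∈ Ω ↔ ρ y < 0)) :
    ∃ C : ℝ≥0∞, C ≠ ⊤ ∧ ∀ f : Fin (m + 1) → Eu (m + 1) → ℝ, (∀ j, ContDiff ℝ ∞ (f j)) →
      (∀ j, tsupport (f j) ⊆ S) →
      ENNReal.ofReal |∫ y in Ω, ∑ j, fderiv ℝ (f j) y (basisVec j)|
        ≤ C * ∫⁻ y in S ∩ {y | ρ y = 0}, ENNReal.ofReal |∑ j, f j y * fderiv ℝ ρ y (basisVec j)|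
          ∂Measure.hausdorffMeasure (m : ℝ) := by
  obtain ⟨M, hM0, hM⟩ := exists_abs_deriv_smoothTransition_le
  refine ⟨ENNReal.ofReal M * (2 * K), ENNReal.mul_ne_top ENNReal.ofReal_ne_top
    (ENNReal.mul_ne_top (by simp) (by simp)), fun f hf hfS => ?_⟩
  have hcs : ∀ j, HasCompactSupport (f j) := fun j =>
    hS.of_isClosed_subset (isClosed_tsupport _) (hfS j)
  set D : Eu (m + 1) → ℝ := fun y => ∑ j, fderiv ℝ (f j) y (basisVec j) with hD
  set g : Eu (m + 1) → ℝ := fun y => |∑ j, f j y * fderiv ℝ ρ y (basisVec j)| with hg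
  have hgc : Continuous g := by
    refine (continuous_finsetSum _ fun j _ => ?_).abs
    exact (hf j).continuous.mul (continuous_fderiv_apply hρ _)
  have hf0 : ∀ j, ∀ y ∉ S, f j y = 0 := fun j y hy =>
    image_eq_zero_of_notMem_tsupport fun h => hy (hfS j h)
  have hdf0 : ∀ j, ∀ y ∉ S, fderiv ℝ (f j) y (basisVec j) = 0 := fun j y hy => by
    rw [image_eq_zero_of_notMem_tsupport (f := fderiv ℝ (f j))
      fun h => hy (hfS j (tsupport_fderiv_subset ℝ h))]
    rfl
  have hgS : ∀ y ∉ S, g y = 0 := fun y hy => by simp [hg, hf0 _ y hy]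
  set η : ℕ → Eu (m + 1) → ℝ := fun k y => Real.smoothTransition (-(k * ρ y)) with hη
  have hηs : ∀ k, ContDiff ℝ ∞ (η k) := fun k =>
    Real.smoothTransition.contDiff.comp (contDiff_const.mul hρ).neg
  have hdη : ∀ k y j, fderiv ℝ (η k) y (basisVec j)
      = -(k * deriv Real.smoothTransition (-(k * ρ y)) * fderiv ℝ ρ y (basisVec j)) :=
    fun k y j => by
      have h1 := (((hρ.differentiable (by simp) y).hasFDerivAt.const_mul (k : ℝ))).neg
      have h2 := (hasDerivAt_smoothTransition _).comp_hasFDerivAt y h1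
      have : η k = Real.smoothTransition ∘ (-fun y => k * ρ y) := rfl
      rw [this, h2.fderiv]
      simp only [Pi.neg_apply, smul_apply, neg_apply,
        smul_eq_mul]
      ring
  have hDi : ∀ j, Integrable (fun y => fderiv ℝ (f j) y (basisVec j)) volume := fun j =>
    (continuous_fderiv_apply (hf j) _).integrable_of_hasCompactSupport
      ((hcs j).fderiv_apply (𝕜 := ℝ) _)
  have hDint : Integrable D volume := integrable_finsetSum _ fun j _ => hDi j
  -- the integral of the divergence is the limit of its integrals against the cutoff functions
  have hlim : Tendsto (fun k : ℕ => ∫ y in Ω, η k y * D y) atTop (𝓝 (∫ y in Ω, D y)) := by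
    refine tendsto_integral_of_dominated_convergence (fun y => ‖D y‖) (fun k => ?_)
      hDint.norm.integrableOn (fun k => ae_of_all _ fun y => ?_) ?_
    · exact (hηs k).continuous.aestronglyMeasurable.mul hDint.aestronglyMeasurable.restrict
    · rw [norm_mul]
      refine mul_le_of_le_one_left (norm_nonneg _) ?_
      rw [Real.norm_of_nonneg (Real.smoothTransition.nonneg _)]
      exact Real.smoothTransition.le_one _
    · filter_upwards [ae_restrict_mem hΩ] with y hy
      by_cases hyS : y ∈ S
      · have hneg : 0 < -ρ y := neg_pos.2 ((hΩS y hyS).1 hy)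
        refine tendsto_const_nhds.congr' ?_
        filter_upwards [(tendsto_natCast_atTop_atTop.atTop_mul_const hneg).eventually_ge_atTop 1]
          with k hk
        rw [hη]
        dsimp only
        rw [Real.smoothTransition.one_of_one_le (by linarith), one_mul]
      · have : D y = 0 := by simp [hD, hdf0 _ y hyS]
        simp [this]
  -- integration by parts
  have hparts : ∀ k : ℕ, ∫ y in Ω, η k y * D y = ∫ y, k * deriv Real.smoothTransition (-(k * ρ y))
      * ∑ j, f j y * fderiv ℝ ρ y (basisVec j) := fun k => by
    have h1 : ∫ y in Ω, η k y * D y = ∫ y, η k y * D y := by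
      refine setIntegral_eq_integral_of_forall_compl_eq_zero fun y hy => ?_
      by_cases hyS : y ∈ S
      · have : 0 ≤ ρ y := not_lt.1 fun h => hy ((hΩS y hyS).2 h)
        have h0 : (0 : ℝ) ≤ k * ρ y := by positivity
        rw [hη]
        dsimp only
        rw [Real.smoothTransition.zero_of_nonpos (by linarith), zero_mul]
      · simp [hD, hdf0 _ y hyS]
    have h2 : ∀ j, Integrable (fun y => η k y * fderiv ℝ (f j) y (basisVec j)) volume := fun j =>
      ((hηs k).continuous.mul (continuous_fderiv_apply (hf j) _)).integrable_of_hasCompactSupport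
        ((hcs j).fderiv_apply (𝕜 := ℝ) _).mul_left
    have h3 : ∀ j, Integrable (fun y => fderiv ℝ (η k) y (basisVec j) * f j y) volume := fun j =>
      ((continuous_fderiv_apply (hηs k) _).mul (hf j).continuous).integrable_of_hasCompactSupport
        (hcs j).mul_left
    have h4 : ∀ j, ∫ y, η k y * fderiv ℝ (f j) y (basisVec j)
        = -∫ y, fderiv ℝ (η k) y (basisVec j) * f j y := fun j =>
      integral_mul_fderiv_eq_neg_fderiv_mul_of_integrable (h3 j) (h2 j)
        (((hηs k).continuous.mul (hf j).continuous).integrable_of_hasCompactSupport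
          (hcs j).mul_left)
        (fun y _ => (hηs k).differentiable (by simp) y)
        (fun y _ => (hf j).differentiable (by simp) y)
    rw [h1]
    simp only [hD, Finset.mul_sum]
    rw [integral_finsetSum _ fun j _ => h2 j]
    simp only [h4, ← integral_neg]
    have h5 : ∀ j, Integrable (fun y => -(fderiv ℝ (η k) y (basisVec j) * f j y)) volume :=
      fun j => (h3 j).neg
    rw [← integral_finsetSum _ fun j _ => h5 j]
    congr 1
    ext y
    refine Finset.sum_congr rfl fun j _ => ?_
    rw [hdη]
    ring
  have hbound : ∀ k : ℕ, ENNReal.ofReal |∫ y in Ω, η k y * D y|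
      ≤ ENNReal.ofReal M * ((k : ℝ≥0∞) *
        ∫⁻ y in {y | |ρ y| ≤ 1 / k}, ENNReal.ofReal (g y)) := fun k => by
    have hlay : MeasurableSet {y | |ρ y| ≤ 1 / (k : ℝ)} :=
      (isClosed_le hρ.continuous.abs continuous_const).measurableSet
    rw [hparts, ← Real.norm_eq_abs, ofReal_norm]
    refine (enorm_integral_le_lintegral_enorm _).trans ?_
    rw [← mul_assoc, ← lintegral_const_mul' _ _ (ENNReal.mul_ne_top ENNReal.ofReal_ne_top
      (ENNReal.natCast_ne_top k)), ← lintegral_indicator hlay]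
    refine lintegral_mono fun y => ?_
    by_cases hy : |ρ y| ≤ 1 / k
    · rw [indicator_of_mem (show y ∈ {y | |ρ y| ≤ 1 / (k : ℝ)} from hy), ← ofReal_norm,
        ← ENNReal.ofReal_natCast, ← ENNReal.ofReal_mul hM0, ← ENNReal.ofReal_mul (by positivity)]
      refine ENNReal.ofReal_le_ofReal ?_
      rw [norm_mul, norm_mul, Real.norm_natCast, Real.norm_eq_abs, Real.norm_eq_abs, mul_comm M]
      gcongr
      exact hM _
    · rw [indicator_of_notMem (show y ∉ {y | |ρ y| ≤ 1 / (k : ℝ)} from hy)]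
      rcases Nat.eq_zero_or_pos k with rfl | hk
      · simp
      have hk' : (0 : ℝ) < k := by exact_mod_cast hk
      rw [deriv_smoothTransition_eq_zero]
      · simp
      · rw [not_le, div_lt_iff₀' hk'] at hy
        rcases lt_abs.1 (show 1 < |k * ρ y| by rwa [abs_mul, abs_of_pos hk']) with h | h
        · left; linarith
        · right; linarith
  have hfin := limsup_layer_le hρ.continuous hS hK hgc hgS
  have hl1 : Tendsto (fun k : ℕ => ENNReal.ofReal |∫ y in Ω, η k y * D y|) atTop
      (𝓝 (ENNReal.ofReal |∫ y in Ω, D y|)) :=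
    (ENNReal.continuous_ofReal.tendsto _).comp hlim.abs
  rw [← hl1.limsup_eq]
  refine (limsup_le_limsup (Eventually.of_forall hbound)).trans ?_
  rw [ENNReal.limsup_const_mul_of_ne_top ENNReal.ofReal_ne_top, mul_assoc]
  gcongr

/-! ### The Laplacian of a function with vanishing normal derivative -/

lemma integral_sum_add {α ι : Type*} [MeasurableSpace α] {μ : Measure α} [Fintype ι]
    {f g : ι → α → ℝ} (hf : ∀ j, Integrable (f j) μ) (hg : ∀ j, Integrable (g j) μ) :
    ∫ y, ∑ j, (f j y + g j y) ∂μ = ∑ j, (∫ y, f j y ∂μ + ∫ y, g j y ∂μ) := by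
  simp only [Finset.sum_add_distrib]
  rw [integral_add (integrable_finsetSum _ fun j _ => hf j)
    (integrable_finsetSum _ fun j _ => hg j), integral_finsetSum _ fun j _ => hf j,
    integral_finsetSum _ fun j _ => hg j]

section Neumann

variable {n : ℕ} {p : ℝ≥0∞} [hp : Fact (1 ≤ p)] {Ω : Set (Eu n)}

/-- The integrand `ψ Δu + ∇ψ · ∇u = div (ψ ∇u)`. -/
def divMul (u : W2 p Ω) (ψ : Eu n → ℝ) (y : Eu n) : ℝ :=
  ∑ j, (ψ y * W2.dd u j j y + fderiv ℝ ψ y (basisVec j) * W2.d u j y)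

lemma integral_divMul_of_tsupport_subset {u : W2 p Ω} {ψ : Eu n → ℝ} (hψ : ContDiff ℝ ∞ ψ)
    (hc : HasCompactSupport ψ) (hs : tsupport ψ ⊆ Ω) : ∫ y in Ω, divMul u ψ y = 0 := by
  have hd : ∀ j, HasWeakPartial Ω j (W2.d u j) (W2.dd u j j) := fun j => u.2.2 j j
  have h1 : ∀ j, IntegrableOn (fun y => ψ y * W2.dd u j j y) Ω := fun j => by
    simpa only [mul_comm] using integrableOn_mul_test (hd j).2.1 hψ.continuous hc hs
  have h2 : ∀ j, IntegrableOn (fun y => fderiv ℝ ψ y (basisVec j) * W2.d u j y) Ω := fun j => by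
    simpa only [mul_comm] using integrableOn_mul_test_deriv (basisVec j) (hd j).1 hψ hc hs
  unfold divMul
  rw [integral_sum_add h1 h2]
  refine Finset.sum_eq_zero fun j _ => ?_
  have := (hd j).2.2 ψ hψ hc hs
  simp only [mul_comm (ψ _), mul_comm (fderiv ℝ ψ _ _)]
  rw [this]
  ring

lemma memLp_d (u : W2 p Ω) (j : Fin n) : MemLp (W2.d u j) p (volume.restrict Ω) := Lp.memLp _

lemma memLp_dd (u : W2 p Ω) (i j : Fin n) : MemLp (W2.dd u i j) p (volume.restrict Ω) := Lp.memLp _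

end Neumann

/-- If the fields `φ_k` converge in `L_p(μ)` to a field that is orthogonal to `b`, then the
components of `φ_k` along `b` tend to zero in `L_1(μ)`. -/
lemma tendsto_lintegral_normal {m : ℕ} {p : ℝ≥0∞} (hp : 1 ≤ p) {μ : Measure (Eu m)}
    [IsFiniteMeasure μ] {S : Set (Eu m)} (hS : IsCompact S) (hμ : ∀ᵐ y ∂μ, y ∈ S)
    {b : Fin m → Eu m → ℝ} (hb : ∀ j, Continuous (b j)) {τ : Fin m → Eu m → ℝ}
    (hτ : ∀ j, MemLp (τ j) p μ) (hτ0 : ∀ᵐ y ∂μ, ∑ j, τ j y * b j y = 0)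
    {φ : Fin m → ℕ → Eu m → ℝ} (hφ : ∀ j k, Continuous (φ j k))
    (h : ∀ j, Tendsto (fun k => eLpNorm (fun y => φ j k y - τ j y) p μ) atTop (𝓝 0)) :
    Tendsto (fun k => ∫⁻ y, ENNReal.ofReal |∑ j, φ j k y * b j y| ∂μ) atTop (𝓝 0) := by
  have hB : ∀ j, ∃ B : ℝ, ∀ y ∈ S, ‖b j y‖ ≤ B := fun j =>
    hS.exists_bound_of_continuousOn (hb j).continuousOn
  choose B hB using hB
  have hm : ∀ j k, AEStronglyMeasurable (fun y => φ j k y - τ j y) μ := fun j k =>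
    (hφ j k).aestronglyMeasurable.sub (hτ j).aestronglyMeasurable
  have hlim : Tendsto (fun k => ∑ j, ENNReal.ofReal (B j) *
      eLpNorm (fun y => φ j k y - τ j y) 1 μ) atTop (𝓝 0) := by
    have : Tendsto (fun k => ∑ j, ENNReal.ofReal (B j) *
        eLpNorm (fun y => φ j k y - τ j y) 1 μ) atTop (𝓝 (∑ j, ENNReal.ofReal (B j) * 0)) :=
      tendsto_finsetSum _ fun j _ => ENNReal.Tendsto.const_mul
        (tendsto_eLpNorm_one_of_tendsto_eLpNorm hp (hm j) (h j)) (Or.inr ENNReal.ofReal_ne_top)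
    simpa using this
  refine tendsto_of_tendsto_of_tendsto_of_le_of_le tendsto_const_nhds hlim
    (fun _ => zero_le) fun k => ?_
  calc ∫⁻ y, ENNReal.ofReal |∑ j, φ j k y * b j y| ∂μ
      ≤ ∫⁻ y, ∑ j, ENNReal.ofReal (B j) * ‖φ j k y - τ j y‖ₑ ∂μ := by
        refine lintegral_mono_ae ?_
        filter_upwards [hμ, hτ0] with y hy hy0
        have e : ∑ j, φ j k y * b j y = ∑ j, b j y * (φ j k y - τ j y) := by
          rw [← sub_zero (∑ j, φ j k y * b j y), ← hy0, ← Finset.sum_sub_distrib]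
          exact Finset.sum_congr rfl fun j _ => by ring
        rw [e, ← Real.norm_eq_abs, ofReal_norm]
        refine (enorm_sum_le _ _).trans (Finset.sum_le_sum fun j _ => ?_)
        rw [enorm_mul]
        gcongr
        rw [← ofReal_norm]
        exact ENNReal.ofReal_le_ofReal (hB j y hy)
    _ = ∑ j, ENNReal.ofReal (B j) * eLpNorm (fun y => φ j k y - τ j y) 1 μ := by
        rw [lintegral_finsetSum' _ fun j _ => (hm j k).enorm.const_mul _]
        refine Finset.sum_congr rfl fun j _ => ?_
        rw [lintegral_const_mul' _ _ ENNReal.ofReal_ne_top, eLpNorm_one_eq_lintegral_enorm]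

/-- Near a boundary point the flux of `ψ ∇u` vanishes if `∂_ν u = 0`: the divergence theorem is
applied to `ψ` times the smooth fields that define the trace of `∇u`. -/
lemma exists_nhds_integral_divMul_boundary {m : ℕ} {p : ℝ≥0∞} [hp : Fact (1 ≤ p)]
    {Ω : Set (Eu (m + 1))} (hΩ : IsSmoothBoundedDomain Ω) {u : W2 p Ω} (hu : NeumannCondition u)
    {x : Eu (m + 1)} (hx : x ∈ frontier Ω) :
    ∃ N ∈ 𝓝 x, ∀ ψ : Eu (m + 1) → ℝ, ContDiff ℝ ∞ ψ → HasCompactSupport ψ →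
      tsupport ψ ⊆ N → ∫ y in Ω, divMul u ψ y = 0 := by
  obtain ⟨ρ, hρ⟩ := hΩ.smooth x hx
  obtain ⟨i, hi⟩ := hρ.exists_partial_ne_zero
  obtain ⟨K, N, hN, hK⟩ := exists_dist_le_of_partial_ne_zero i hρ.1 hi
  refine ⟨N ∩ {y | (y ∈ Ω ↔ ρ y < 0) ∧ (ρ y = 0 → IsLocalDefiningFunction Ω y ρ)},
    inter_mem hN hρ.eventually_nhds, fun ψ hψ hc hs => ?_⟩
  set S := tsupport ψ with hSdef
  have hS : IsCompact S := hc
  have hKS : ∀ a ∈ S, ∀ b ∈ S, dist a b ≤ K * max |ρ a - ρ b| (dist (drop i a) (drop i b)) :=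
    fun a ha b hb => hK a (hs ha).1 b (hs hb).1
  have hO := hΩ.isOpen
  obtain ⟨C, hC, hdiv⟩ := exists_integral_div_le hO.measurableSet hρ.1 hS hKS
    fun y hy => (hs hy).2.1
  obtain ⟨τ, hτ, hν⟩ := hu
  choose hτm φ hφ h1 h2 h3 using hτ
  have : IsFiniteMeasure ((volume : Measure (Eu (m + 1))).restrict Ω) :=
    ⟨by rw [Measure.restrict_apply_univ]; exact hΩ.isBounded.measure_lt_top⟩
  have hKc : IsCompact (closure Ω) := hΩ.isBounded.isCompact_closure
  have hμ : ∀ᵐ y ∂volume.restrict Ω, y ∈ closure Ω := by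
    filter_upwards [ae_restrict_mem hO.measurableSet] with y hy using subset_closure hy
  -- the divergences of the approximating fields
  have hfs : ∀ k j, ContDiff ℝ ∞ (fun y => ψ y * φ j k y) := fun k j => hψ.mul (hφ j k)
  have hfS : ∀ k j, tsupport (fun y => ψ y * φ j k y) ⊆ S := fun k j => tsupport_mul_subset_left
  have hder : ∀ k y, ∑ j, fderiv ℝ (fun y => ψ y * φ j k y) y (basisVec j)
      = ∑ j, (ψ y * fderiv ℝ (φ j k) y (basisVec j)
        + fderiv ℝ ψ y (basisVec j) * φ j k y) := fun k y => by
    refine Finset.sum_congr rfl fun j _ => ?_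
    rw [fderiv_fun_mul (hψ.differentiable (by simp) y) ((hφ j k).differentiable (by simp) y)]
    simp [mul_comm]
  have hon : ∀ {g : Eu (m + 1) → ℝ}, Continuous g → IntegrableOn g Ω := fun hg =>
    (hg.continuousOn.integrableOn_compact hKc).mono_set subset_closure
  have hcψ := hψ.continuous
  have hcdψ := fun j : Fin (m + 1) => continuous_fderiv_apply hψ (basisVec j)
  have hcdφ := fun k (j : Fin (m + 1)) => continuous_fderiv_apply (hφ j k) (basisVec j)
  have hlim : Tendsto (fun k => ∫ y in Ω, ∑ j, fderiv ℝ (fun y => ψ y * φ j k y) y (basisVec j))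
      atTop (𝓝 (∫ y in Ω, divMul u ψ y)) := by
    have hl := fun j => (tendsto_integral_mul_of_tendsto_eLpNorm hp.out hcψ.continuousOn hKc hμ
      (fun k => hcdφ k j) (memLp_dd u j j) (h2 j j)).add
      (tendsto_integral_mul_of_tendsto_eLpNorm hp.out (hcdψ j).continuousOn hKc hμ
      (fun k => (hφ j k).continuous) (memLp_d u j) (h1 j))
    have hl' := tendsto_finsetSum Finset.univ fun j _ => hl j
    have i1 : ∀ j, Integrable (fun y => ψ y * W2.dd u j j y) (volume.restrict Ω) := fun j =>
      integrable_continuousOn_mul hcψ.continuousOn hKc hμ ((memLp_dd u j j).integrable hp.out)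
    have i2 : ∀ j, Integrable (fun y => fderiv ℝ ψ y (basisVec j) * W2.d u j y)
        (volume.restrict Ω) := fun j =>
      integrable_continuousOn_mul (hcdψ j).continuousOn hKc hμ ((memLp_d u j).integrable hp.out)
    have e1 : ∫ y in Ω, divMul u ψ y = ∑ j, ((∫ y in Ω, ψ y * W2.dd u j j y)
        + ∫ y in Ω, fderiv ℝ ψ y (basisVec j) * W2.d u j y) := by
      unfold divMul
      exact integral_sum_add i1 i2
    rw [e1]
    refine hl'.congr fun k => ?_
    simp only [hder]
    exact (integral_sum_add (fun j => hon (hcψ.mul (hcdφ k j)))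
      (fun j => hon ((hcdψ j).mul (hφ j k).continuous))).symm
  -- the normal components of the approximating fields on the boundary
  set A := S ∩ {y | ρ y = 0} with hA
  have hAm : MeasurableSet A :=
    (hS.inter_right (isClosed_eq hρ.1.continuous continuous_const)).measurableSet
  set σ := (Measure.hausdorffMeasure (m : ℝ) : Measure (Eu (m + 1))).restrict A with hσ
  have : IsFiniteMeasure σ :=
    ⟨by rw [hσ, Measure.restrict_apply_univ]
        exact hausdorffMeasure_zeroSet_lt_top hρ.1.continuous hS hKS⟩
  have hAF : A ⊆ frontier Ω := fun y hy => ((hs hy.1).2.2 hy.2).mem_frontier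
  have hbm : σ = (boundaryMeasure Ω).restrict A := by
    have : ((m + 1 : ℕ) : ℝ) - 1 = m := by push_cast; ring
    rw [boundaryMeasure, this, Measure.restrict_restrict hAm, inter_eq_left.2 hAF]
  have hσle : σ ≤ boundaryMeasure Ω := hbm ▸ Measure.restrict_le_self
  have hσS : ∀ᵐ y ∂σ, y ∈ S := by
    filter_upwards [ae_restrict_mem hAm] with y hy using hy.1
  have hnormal := tendsto_lintegral_normal hp.out hS hσS
    (b := fun j y => ψ y * fderiv ℝ ρ y (basisVec j))
    (fun j => hcψ.mul (continuous_fderiv_apply hρ.1 _)) (τ := τ)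
    (fun j => (hτm j).mono_measure hσle) (by
      have hν' := hbm ▸ ae_restrict_of_ae (s := A) hν
      filter_upwards [hν', ae_restrict_mem hAm] with y ⟨ν, h5, h6⟩ hy
      have := ((hs hy.1).2.2 hy.2).sum_mul_partial_eq_zero h5 h6
      rw [← mul_zero (ψ y), ← this, Finset.mul_sum]
      exact Finset.sum_congr rfl fun j _ => by ring)
    (fun j k => (hφ j k).continuous) (fun j => tendsto_of_tendsto_of_tendsto_of_le_of_le
      tendsto_const_nhds (h3 j) (fun _ => zero_le) fun k => eLpNorm_mono_measure _ hσle)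
  have hzero : ENNReal.ofReal |∫ y in Ω, divMul u ψ y| ≤ 0 := by
    have hright := ENNReal.Tendsto.const_mul hnormal (Or.inr hC)
    rw [mul_zero] at hright
    refine le_of_tendsto_of_tendsto' ((ENNReal.continuous_ofReal.tendsto _).comp hlim.abs) hright
      fun k => (hdiv _ (hfs k) (hfS k)).trans (le_of_eq ?_)
    congr 2
    ext y
    congr 2
    exact Finset.sum_congr rfl fun j _ => by ring
  rw [nonpos_iff_eq_zero, ENNReal.ofReal_eq_zero] at hzero
  exact abs_nonpos_iff.1 hzero

open scoped Manifold in
/-- The Laplacian of a function in `W_p^2(Ω)` with vanishing normal derivative has mean zero: the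
integrals of `div (ψ ∇u)` vanish for `ψ` in a partition of unity on the closure of `Ω`. -/
lemma integral_laplacian_eq_zero {n : ℕ} (hn : 1 ≤ n) {p : ℝ≥0∞} [hp : Fact (1 ≤ p)]
    {Ω : Set (Eu n)} (hΩ : IsSmoothBoundedDomain Ω) {u : W2 p Ω} (hu : NeumannCondition u) :
    ∫ y in Ω, W2.laplacian u y = 0 := by
  obtain ⟨m, rfl⟩ : ∃ m, n = m + 1 := ⟨n - 1, by omega⟩
  have hO := hΩ.isOpen
  have hloc : ∀ x ∈ closure Ω, ∃ N ∈ 𝓝 x, ∀ ψ : Eu (m + 1) → ℝ, ContDiff ℝ ∞ ψ →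
      HasCompactSupport ψ → tsupport ψ ⊆ N → ∫ y in Ω, divMul u ψ y = 0 := fun x hx => by
    by_cases hxO : x ∈ Ω
    · exact ⟨Ω, hO.mem_nhds hxO, fun ψ h1 h2 h3 => integral_divMul_of_tsupport_subset h1 h2 h3⟩
    · exact exists_nhds_integral_divMul_boundary hΩ hu ⟨hx, by rwa [hO.interior_eq]⟩
  choose! N hN hNψ using hloc
  have hKc : IsCompact (closure Ω) := hΩ.isBounded.isCompact_closure
  set V : Eu (m + 1) → Set (Eu (m + 1)) := fun x => interior (N x) ∩ ball x 1 with hV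
  obtain ⟨t, ht, hcov⟩ := hKc.elim_nhds_subcover V fun x hx =>
    inter_mem (interior_mem_nhds.2 (hN x hx)) (ball_mem_nhds x one_pos)
  obtain ⟨f, hf⟩ := SmoothPartitionOfUnity.exists_isSubordinate 𝓘(ℝ, Eu (m + 1)) isClosed_closure
    (fun x : t => V x) (fun x => isOpen_interior.inter isOpen_ball)
    fun y hy => by
      obtain ⟨x, hx, hxy⟩ := mem_iUnion₂.1 (hcov hy)
      exact mem_iUnion.2 ⟨⟨x, hx⟩, hxy⟩
  have hfs : ∀ x : t, ContDiff ℝ ∞ (f x) := fun x => (f x).contMDiff.contDiff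
  have hfc : ∀ x : t, HasCompactSupport (f x) := fun x =>
    (isCompact_closedBall x.1 1).of_isClosed_subset (isClosed_tsupport _)
      ((hf x).trans (inter_subset_right.trans ball_subset_closedBall))
  have hzero : ∀ x : t, ∫ y in Ω, divMul u (f x) y = 0 := fun x =>
    hNψ x (ht x x.2) (f x) (hfs x) (hfc x) ((hf x).trans (inter_subset_left.trans interior_subset))
  have hsum : ∀ y ∈ Ω, ∑ x, f x y = 1 := fun y hy => by
    rw [← finsum_eq_sum_of_fintype]
    exact f.sum_eq_one (subset_closure hy)
  have hdsum : ∀ y ∈ Ω, ∀ v, ∑ x, fderiv ℝ (f x) y v = 0 := fun y hy v => by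
    have h1 : (fun z => ∑ x, f x z) =ᶠ[𝓝 y] fun _ => 1 := by
      filter_upwards [hO.mem_nhds hy] with z hz using hsum z hz
    have h2 := h1.fderiv_eq (𝕜 := ℝ)
    rw [fderiv_fun_sum fun x _ => (hfs x).differentiable (by simp) y, fderiv_fun_const] at h2
    simpa using congrArg (fun L => L v) h2
  have : IsFiniteMeasure ((volume : Measure (Eu (m + 1))).restrict Ω) :=
    ⟨by rw [Measure.restrict_apply_univ]; exact hΩ.isBounded.measure_lt_top⟩
  have hμ : ∀ᵐ y ∂volume.restrict Ω, y ∈ closure Ω := by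
    filter_upwards [ae_restrict_mem hO.measurableSet] with y hy using subset_closure hy
  have hint : ∀ x : t, Integrable (divMul u (f x)) (volume.restrict Ω) := fun x =>
    integrable_finsetSum _ fun j _ =>
      (integrable_continuousOn_mul (hfs x).continuous.continuousOn hKc hμ
        ((memLp_dd u j j).integrable hp.out)).add
      (integrable_continuousOn_mul (continuous_fderiv_apply (hfs x) _).continuousOn hKc hμ
        ((memLp_d u j).integrable hp.out))
  have hlap : ∀ᵐ y ∂volume.restrict Ω, W2.laplacian u y = ∑ j, W2.dd u j j y := by
    unfold W2.laplacian
    filter_upwards [Lp.coeFn_finsetSum Finset.univ (fun j => W2.dd u j j)] with y hy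
    rw [hy, Finset.sum_apply]
  calc ∫ y in Ω, W2.laplacian u y = ∫ y in Ω, ∑ x, divMul u (f x) y := by
        refine integral_congr_ae ?_
        filter_upwards [hlap, ae_restrict_mem hO.measurableSet] with y hy hyO
        rw [hy]
        unfold divMul
        rw [Finset.sum_comm]
        refine Finset.sum_congr rfl fun j _ => ?_
        rw [Finset.sum_add_distrib, ← Finset.sum_mul, ← Finset.sum_mul, hsum y hyO,
          hdsum y hyO, one_mul, zero_mul, add_zero]
    _ = ∑ x, ∫ y in Ω, divMul u (f x) y := integral_finsetSum _ fun x _ => hint x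
    _ = 0 := Finset.sum_eq_zero fun x _ => hzero x

/-! ### Conservation of mass -/

/-- The total mass is a bounded functional of `(u, Φ^* U)`, and it vanishes on the right-hand sides
`(q - f, -F)` of the evolution equation: the mass `∫ q` that enters `Ω` is the mass that leaves the
cells, and `∫ f` vanishes by the Neumann condition. -/
lemma exists_totalMass_functional {n : ℕ} (hn : 1 ≤ n) {p : ℝ≥0∞} [hp : Fact (1 ≤ p)]
    (hp_top : p ≠ ⊤) {Ω : Set (Eu n)} (hΩ : IsSmoothBoundedDomain Ω) {Ψ : Eu n → Eu n → Eu n}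
    (hΨ : IsCellGeometry p Ω Ψ) :
    ∃ L : LpOn p Ω × LpBochner p Ω (LpOn p (unitBall n)) →L[ℝ] ℝ,
      (∀ u (U : LpQ p Ω Ψ) V, IsPullback U V → totalMass u U = L (u, V)) ∧
      ∀ u V f F q, IsNeumannOperator Ψ u V f F q → L ((q, 0) - (f, F)) = 0 := by
  have hO := hΩ.isOpen.measurableSet
  have hB : MeasurableSet (unitBall n) := measurableSet_ball
  have : IsFiniteMeasure ((volume : Measure (Eu n)).restrict Ω) :=
    ⟨by rw [Measure.restrict_apply_univ]; exact hΩ.isBounded.measure_lt_top⟩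
  obtain ⟨w, hw, ⟨C, hC⟩, hwe⟩ := hΨ.exists_measurable_sqrtG hO
  obtain ⟨L₂, hL₂⟩ := exists_kernel_functional hp_top (Ω := Ω) hw hC
  obtain ⟨M, -, hM⟩ := exists_integral_functional (α := Eu n) (X := ℝ) (p := p)
    (μ := (volume : Measure (Eu n)).restrict Ω) zero_le_one
  obtain ⟨L₁, -, hL₁⟩ := hM (fun _ => ContinuousLinearMap.id ℝ ℝ) (fun v => measurable_const)
    (fun _ => ContinuousLinearMap.norm_id_le)
  refine ⟨L₁.coprod L₂, fun u U V hUV => ?_, fun u V f F q h => ?_⟩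
  · rw [ContinuousLinearMap.coprod_apply, (hL₁ u).2, (hL₂ V).2, totalMass]
    congr 1
    refine integral_congr_ae ?_
    filter_upwards [hUV, ae_restrict_mem hO] with x hx hxΩ
    refine integral_congr_ae ?_
    filter_upwards [hx, ae_restrict_mem hB] with y hy hyB
    rw [hwe x hxΩ y hyB, hy]
  · obtain ⟨⟨v, -, hv, rfl⟩, W, hW⟩ := h
    have e1 : L₁ (W2.laplacian v) = 0 := by
      rw [(hL₁ _).2]
      exact integral_laplacian_eq_zero hn hΩ hv
    have e2 : L₂ F = L₁ q := by
      rw [(hL₁ q).2, (hL₂ F).2]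
      refine integral_congr_ae ?_
      filter_upwards [hW, ae_restrict_mem hO] with x ⟨_, _, hF, hq⟩ hxΩ
      refine Eq.trans ?_ (integral_sqrtG_laplaceBeltrami hn hΨ hxΩ hF hq)
      exact setIntegral_congr_fun hB fun y hyB => by rw [hwe x hxΩ y hyB]
    rw [ContinuousLinearMap.coprod_apply, Prod.fst_sub, Prod.snd_sub, zero_sub, map_sub, map_neg,
      map_neg, e1, e2, neg_zero, sub_zero, add_neg_cancel]

end Matched

end

theorem mainTheorem7 (n : ℕ) (hn : 1 ≤ n) (p : ℝ≥0∞) [Fact (1 ≤ p)] (hp : 2 ≤ p) (hp_top : p ≠ ⊤)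
    (Ω : Set (Matched.Eu n)) (hΩ : Matched.IsSmoothBoundedDomain Ω)
    (Ψ : Matched.Eu n → Matched.Eu n → Matched.Eu n) (hΨ : Matched.IsCellGeometry p Ω Ψ)
    (T : ℝ) (hT : 0 < T)
    (u₀ : Matched.LpOn p Ω) (U₀ : Matched.LpQ p Ω Ψ)
    (hu₀ : Matched.MemW1 u₀) (hU₀ : Matched.MemLpW1 U₀)
    (u : ℝ → Matched.LpOn p Ω) (U : ℝ → Matched.LpQ p Ω Ψ)
    (h : Matched.IsNeumannSolution T u₀ U₀ u U) :
    ∀ t ∈ Set.Icc 0 T, Matched.totalMass (u t) (U t) = Matched.totalMass u₀ U₀ := by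
  obtain ⟨L, hL, hL0⟩ := Matched.exists_totalMass_functional hn hp_top hΩ hΨ
  obtain ⟨V, hV, hcont, hder⟩ := h.evolution
  intro t ht
  rw [← h.initial.1, ← h.initial.2, hL _ _ _ (hV t ht),
    hL _ _ _ (hV 0 (left_mem_Icc.2 hT.le))]
  rcases ht.1.eq_or_lt with rfl | ht0
  · rfl
  have hd : ∀ s ∈ Ioo 0 t, HasDerivAt (fun s => L (u s, V s)) 0 s := fun s hs => by
    obtain ⟨f, F, q, hop, hd⟩ := hder s ⟨hs.1, hs.2.trans_le ht.2⟩
    rw [← hL0 _ _ _ _ _ hop]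
    exact L.hasFDerivAt.comp_hasDerivAt s hd
  obtain ⟨s, -, hs⟩ := exists_hasDerivAt_eq_slope (fun s => L (u s, V s)) (fun _ => 0) ht0
    (L.continuous.comp_continuousOn (hcont.mono (Icc_subset_Icc_right ht.2))) hd
  have h0 : t - 0 ≠ 0 := by simpa using ht0.ne'
  rw [eq_div_iff h0, zero_mul] at hs
  exact sub_eq_zero.1 hs.symm
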